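/- Let $(R,\mathfrak m,k)$ be a commutative noetherian local ring and let $A=\operatorname{gr}_{\mathfrak m}R=\bigoplus_{n\ge 0}\mathfrak m^n/\mathfrak m^{n+1}$ be its associated graded ring. For an $R$-module $N$ let $\operatorname{gr}_{\mathfrak m}N=\bigoplus_{n\ge 0}\mathfrak m^nN/\mathfrak m^{n+1}N$, a graded $A$-module. If $N$ is finitely generated and $F$ is a minimal free resolution of $N$, the linear part $\operatorname{lin}^RF$ is the complex of $A$-modules with $\operatorname{lin}^R_nF=\operatorname{gr}_{\mathfrak m}(F_n)(-n)$, that is, the associated graded complex of $F$ for the filtration by the subcomplexes with $n$-th term $\mathfrak m^{i-n}F_n$, $i\in\mathbb Z$ (where $\mathfrak m^j=R$ for $j\le 0$). The linearity defect of $N$ is $$\operatorname{ld}_RN=\sup\{i : H_i(\operatorname{lin}^RF)\ne 0\},$$ and $N$ is called Koszul if $\operatorname{ld}_RN=0$. For an ideal $J\subseteq A$, $\operatorname{depth}_A(J;\operatorname{gr}_{\mathfrak m}N)$ denotes the supremum of the lengths of $\operatorname{gr}_{\mathfrak m}N$-regular sequences in $J$. Theorem 2.11. Let $\boldsymbol x=x_1,\dots,x_c$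 be elements of $\mathfrak m$, and let $\overline{\boldsymbol x}=\overline x_1,\dots,\overline x_c$ be their images in $A_1=\mathfrak m/\mathfrak m^2$. The following statements hold for each finitely generated $R$-module $M$. (a) If $\boldsymbol x$ is $M$-regular and $M$ is Koszul, then $$\operatorname{ld}_R(M/\boldsymbol xM)=c-\operatorname{depth}_A(A\overline{\boldsymbol x};\operatorname{gr}_{\mathfrak m}M).$$ In particular, $M/\boldsymbol xM$ is Koszul if and only if $\overline{\boldsymbol x}$ is regular on $\operatorname{gr}_{\mathfrak m}M$. (b) If $\boldsymbol x$ is $M$-regular and $M/\boldsymbol xM$ is Koszul, then $M$ is Koszul. (c) If $\overline{\boldsymbol x}$ is regular on $\operatorname{gr}_{\mathfrak m}M$, then $M$ is Koszul if and only if $M/\boldsymbol xM$ is Koszul. -/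

import Mathlib

universe u

open CategoryTheory DirectSum

noncomputable section

namespace LinDefect

section AssociatedGraded

variable {R : Type u} [CommRing R] (I : Ideal R)

/-- The degree `n` component `I ^ n M / I ^ (n + 1) M` of the associated graded module of `M` with
respect to the `I`-adic filtration. -/
def GrPiece (M : Type u) [AddCommGroup M] [Module R M] (n : ℕ) : Type u :=
  ↥(I ^ n • ⊤ : Submodule R M) ⧸
    Submodule.submoduleOf (I ^ (n + 1) • ⊤ : Submodule R M) (I ^ n • ⊤ : Submodule R M)

section Pieces

variable (M : Type u) [AddCommGroup M] [Module R M]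

instance (n : ℕ) : AddCommGroup (GrPiece I M n) :=
  inferInstanceAs (AddCommGroup (_ ⧸ Submodule.submoduleOf (I ^ (n + 1) • ⊤ : Submodule R M)
    (I ^ n • ⊤ : Submodule R M)))

instance (n : ℕ) : Module R (GrPiece I M n) :=
  inferInstanceAs (Module R (_ ⧸ Submodule.submoduleOf (I ^ (n + 1) • ⊤ : Submodule R M)
    (I ^ n • ⊤ : Submodule R M)))

/-- The class in `I ^ n M / I ^ (n + 1) M` of an element of `I ^ n M`. -/
def grMk (n : ℕ) : ↥(I ^ n • ⊤ : Submodule R M) →ₗ[R] GrPiece I M n :=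
  Submodule.mkQ _

variable {M}

lemma grMk_surjective (n : ℕ) : Function.Surjective (grMk I M n) :=
  Submodule.mkQ_surjective _

lemma grMk_eq_zero_iff {n : ℕ} (a : ↥(I ^ n • ⊤ : Submodule R M)) :
    grMk I M n a = 0 ↔ (a : M) ∈ (I ^ (n + 1) • ⊤ : Submodule R M) :=
  Submodule.Quotient.mk_eq_zero _

lemma grMk_congr {n n' : ℕ} (h : n = n') (a : ↥(I ^ n • ⊤ : Submodule R M))
    (b : ↥(I ^ n' • ⊤ : Submodule R M)) (hab : (a : M) = b) :
    (⟨n, grMk I M n a⟩ : GradedMonoid (GrPiece I M)) = ⟨n', grMk I M n' b⟩ := by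
  subst h
  rw [Subtype.ext hab]

end Pieces

section Mul

variable (M : Type u) [AddCommGroup M] [Module R M]

lemma smul_mem_pow {i j : ℕ} {a : R} {b : M} (ha : a ∈ (I ^ i • ⊤ : Submodule R R))
    (hb : b ∈ (I ^ j • ⊤ : Submodule R M)) : a • b ∈ (I ^ (i + j) • ⊤ : Submodule R M) := by
  rw [pow_add, ← smul_eq_mul, Submodule.smul_assoc]
  refine Submodule.smul_mem_smul ?_ hb
  simpa using ha

/-- Scalar multiplication `I ^ i × I ^ j M → I ^ (i + j) M`. -/
def powSMul (i j : ℕ) : ↥(I ^ i • ⊤ : Submodule R R) →ₗ[R] ↥(I ^ j • ⊤ : Submodule R M) →ₗ[R]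
    ↥(I ^ (i + j) • ⊤ : Submodule R M) :=
  LinearMap.mk₂ R (fun a b => ⟨(a : R) • (b : M), smul_mem_pow I M a.2 b.2⟩)
    (fun _ _ _ => Subtype.ext (add_smul _ _ _))
    (fun _ _ _ => Subtype.ext (smul_assoc _ _ _))
    (fun _ _ _ => Subtype.ext (smul_add _ _ _))
    (fun _ _ _ => Subtype.ext (smul_comm _ _ _))

/-- The multiplication of the component of degree `i` of the associated graded ring with the
component of degree `j` of the associated graded module: the class of `a` times the class of `b` is
the class of `a • b`. -/
def grSMul (i j : ℕ) : GrPiece I R i →ₗ[R] GrPiece I M j →ₗ[R] GrPiece I M (i + j) :=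
  Submodule.liftQ _
    (LinearMap.flip (Submodule.liftQ _ (LinearMap.flip
      ((powSMul I M i j).compr₂ (grMk I M (i + j)))) (by
        intro b hb
        ext a
        refine (grMk_eq_zero_iff I _).2 ?_
        have := smul_mem_pow I M a.2 (show (b : M) ∈ (I ^ (j + 1) • ⊤ : Submodule R M) from hb)
        exact this)))
    (by
      intro a ha
      ext b
      obtain ⟨b, rfl⟩ := grMk_surjective I j b
      refine (grMk_eq_zero_iff I _).2 ?_
      have := smul_mem_pow I M (show (a : R) ∈ (I ^ (i + 1) • ⊤ : Submodule R R) from ha) b.2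
      rw [show i + j + 1 = i + 1 + j by ring]
      exact this)

lemma grSMul_mk {i j : ℕ} (a : ↥(I ^ i • ⊤ : Submodule R R)) (b : ↥(I ^ j • ⊤ : Submodule R M)) :
    grSMul I M i j (grMk I R i a) (grMk I M j b) =
      grMk I M (i + j) ⟨(a : R) • (b : M), smul_mem_pow I M a.2 b.2⟩ :=
  rfl

end Mul

lemma mem_pow_zero_smul_top (M : Type u) [AddCommGroup M] [Module R M] (a : M) :
    a ∈ (I ^ 0 • ⊤ : Submodule R M) := by
  simp

instance : GradedMonoid.GOne (GrPiece I R) where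
  one := grMk I R 0 ⟨1, mem_pow_zero_smul_top I R 1⟩

instance : GradedMonoid.GMul (GrPiece I R) where
  mul {i j} a b := grSMul I R i j a b

/-- The graded ring structure on the associated graded ring of `R` with respect to `I`. -/
instance : DirectSum.GCommRing (GrPiece I R) where
  mul_zero {i j} a := map_zero (grSMul I R i j a)
  zero_mul {i j} b := LinearMap.map_zero₂ (grSMul I R i j) b
  mul_add {i j} a b c := map_add (grSMul I R i j a) b c
  add_mul {i j} a b c := LinearMap.map_add₂ (grSMul I R i j) a b c
  one_mul := by
    rintro ⟨i, a⟩
    obtain ⟨a, rfl⟩ := grMk_surjective I i a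
    exact grMk_congr I (zero_add i) _ _ (one_mul (a : R))
  mul_one := by
    rintro ⟨i, a⟩
    obtain ⟨a, rfl⟩ := grMk_surjective I i a
    exact grMk_congr I (add_zero i) _ _ (mul_one (a : R))
  mul_assoc := by
    rintro ⟨i, a⟩ ⟨j, b⟩ ⟨k, c⟩
    obtain ⟨a, rfl⟩ := grMk_surjective I i a
    obtain ⟨b, rfl⟩ := grMk_surjective I j b
    obtain ⟨c, rfl⟩ := grMk_surjective I k c
    exact grMk_congr I (add_assoc i j k) _ _ (mul_assoc (a : R) b c)
  mul_comm := by
    rintro ⟨i, a⟩ ⟨j, b⟩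
    obtain ⟨a, rfl⟩ := grMk_surjective I i a
    obtain ⟨b, rfl⟩ := grMk_surjective I j b
    exact grMk_congr I (add_comm i j) _ _ (mul_comm (a : R) b)
  natCast n := grMk I R 0 ⟨n, mem_pow_zero_smul_top I R n⟩
  natCast_zero := (grMk_eq_zero_iff I _).2 (by simp)
  natCast_succ n := by
    rw [show GradedMonoid.GOne.one = grMk I R 0 ⟨1, mem_pow_zero_smul_top I R 1⟩ from rfl,
      ← map_add]
    congr 1
    exact Subtype.ext (Nat.cast_succ n)
  intCast n := grMk I R 0 ⟨n, mem_pow_zero_smul_top I R n⟩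
  intCast_ofNat n := by simp
  intCast_negSucc_ofNat n := by
    rw [← map_neg]
    congr 1
    exact Subtype.ext (Int.cast_negSucc n)

/-- The graded module structure on the associated graded module of `M`. -/
instance (M : Type u) [AddCommGroup M] [Module R M] :
    DirectSum.Gmodule (GrPiece I R) (GrPiece I M) where
  smul {i j} a b := grSMul I M i j a b
  one_smul := by
    rintro ⟨i, a⟩
    obtain ⟨a, rfl⟩ := grMk_surjective I i a
    exact grMk_congr I (zero_add i) _ _ (one_smul R (a : M))
  mul_smul := by
    rintro ⟨i, a⟩ ⟨j, b⟩ ⟨k, c⟩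
    obtain ⟨a, rfl⟩ := grMk_surjective I i a
    obtain ⟨b, rfl⟩ := grMk_surjective I j b
    obtain ⟨c, rfl⟩ := grMk_surjective I k c
    exact grMk_congr I (add_assoc i j k) _ _ (mul_smul (a : R) (b : R) (c : M))
  smul_add {i j} a b c := map_add (grSMul I M i j a) b c
  smul_zero {i j} a := map_zero (grSMul I M i j a)
  add_smul {i j} a b c := LinearMap.map_add₂ (grSMul I M i j) a b c
  zero_smul {i j} b := LinearMap.map_zero₂ (grSMul I M i j) b

/-- The associated graded ring `⨁ n, I ^ n / I ^ (n + 1)`. -/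
abbrev GrRing : Type u := ⨁ n, GrPiece I R n

/-- The associated graded module `⨁ n, I ^ n M / I ^ (n + 1) M`, a module over `GrRing I`. -/
abbrev GrModule (M : Type u) [AddCommGroup M] [Module R M] : Type u := ⨁ n, GrPiece I M n

/-- The image of `x ∈ I` in the component `I / I ^ 2` of degree one of the associated graded ring.
-/
def degreeOneClass (x : I) : GrRing I :=
  DirectSum.of (GrPiece I R) 1 (grMk I R 1 ⟨x, by simp⟩)

end AssociatedGraded

section LinearPart

variable {R : Type u} [CommRing R] (I : Ideal R)

section Map

variable {M N : Type u} [AddCommGroup M] [Module R M] [AddCommGroup N] [Module R N]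

lemma map_mem_pow_succ (f : M →ₗ[R] N) (hf : LinearMap.range f ≤ I • ⊤) {n : ℕ} {a : M}
    (ha : a ∈ (I ^ n • ⊤ : Submodule R M)) : f a ∈ (I ^ (n + 1) • ⊤ : Submodule R N) := by
  have h := Submodule.mem_map_of_mem (f := f) ha
  rw [Submodule.map_smul'', Submodule.map_top] at h
  rw [pow_succ, ← smul_eq_mul, Submodule.smul_assoc]
  exact Submodule.smul_mono le_rfl hf h

/-- The map `I ^ n M / I ^ (n + 1) M → I ^ (n + 1) N / I ^ (n + 2) N` induced by a linear map
`f : M → N` with `f(M) ⊆ I N`. -/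
def grPieceShift (f : M →ₗ[R] N) (hf : LinearMap.range f ≤ I • ⊤) (n : ℕ) :
    GrPiece I M n →ₗ[R] GrPiece I N (n + 1) :=
  Submodule.liftQ _ ((grMk I N (n + 1)).comp (f.restrict fun _ ha => map_mem_pow_succ I f hf ha))
    (fun a ha => (grMk_eq_zero_iff I _).2
      (map_mem_pow_succ I f hf (show (a : M) ∈ (I ^ (n + 1) • ⊤ : Submodule R M) from ha)))

lemma grPieceShift_mk (f : M →ₗ[R] N) (hf : LinearMap.range f ≤ I • ⊤) (n : ℕ)
    (a : ↥(I ^ n • ⊤ : Submodule R M)) :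
    grPieceShift I f hf n (grMk I M n a) = grMk I N (n + 1) ⟨f a, map_mem_pow_succ I f hf a.2⟩ :=
  rfl

/-- The `GrRing I`-linear map `gr M → gr N`, homogeneous of degree one, which is induced by a linear
map `f : M → N` with `f(M) ⊆ I N`. -/
def grShift (f : M →ₗ[R] N) (hf : LinearMap.range f ≤ I • ⊤) :
    GrModule I M →ₗ[GrRing I] GrModule I N where
  __ := DirectSum.toAddMonoid fun n =>
    (DirectSum.of (GrPiece I N) (n + 1)).comp (grPieceShift I f hf n).toAddMonoidHom
  map_smul' r m := by
    simp only [ZeroHom.toFun_eq_coe, AddMonoidHom.toZeroHom_coe, RingHom.id_apply]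
    induction r using DirectSum.induction_on with
    | zero => simp only [zero_smul, map_zero]
    | add r s hr hs => simp only [add_smul, map_add, hr, hs]
    | of i a =>
      induction m using DirectSum.induction_on with
      | zero => simp only [smul_zero, map_zero]
      | add m n hm hn => simp only [smul_add, map_add, hm, hn]
      | of j b =>
        obtain ⟨a, rfl⟩ := grMk_surjective I i a
        obtain ⟨b, rfl⟩ := grMk_surjective I j b
        rw [DirectSum.Gmodule.of_smul_of, DirectSum.toAddMonoid_of, DirectSum.toAddMonoid_of]
        refine Eq.trans ?_ (DirectSum.Gmodule.of_smul_of _ _ _ _).symm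
        exact DirectSum.of_eq_of_gradedMonoid_eq
          (grMk_congr I (add_assoc i j 1) _ _ (map_smul f (a : R) (b : M)))

lemma grShift_of_mk (f : M →ₗ[R] N) (hf : LinearMap.range f ≤ I • ⊤) (n : ℕ)
    (a : ↥(I ^ n • ⊤ : Submodule R M)) :
    grShift I f hf (DirectSum.of (GrPiece I M) n (grMk I M n a)) =
      DirectSum.of (GrPiece I N) (n + 1)
        (grMk I N (n + 1) ⟨f a, map_mem_pow_succ I f hf a.2⟩) :=
  DirectSum.toAddMonoid_of _ _ _

end Map

/-- A complex of finitely generated free modules whose differentials satisfy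
`∂(F (n + 1)) ⊆ I F n`. Over a local ring with maximal ideal `I` these are the minimal complexes of
finitely generated free modules. -/
structure IsMinimalFree (F : ChainComplex (ModuleCat.{u} R) ℕ) : Prop where
  free (n : ℕ) : Module.Free R (F.X n)
  finite (n : ℕ) : Module.Finite R (F.X n)
  range_d_le (n : ℕ) : LinearMap.range (F.d (n + 1) n).hom ≤ I • ⊤

/-- The linear part of a minimal complex `F`: the associated graded complex with respect to the
filtration whose `i`-th term is `I ^ (i - n) F n` in homological degree `n`. In homological degree
`n` it is `gr F n` (with its grading shifted by `n`, which is not recorded), and the differential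
sends the class in `I ^ j F (n + 1) / I ^ (j + 1) F (n + 1)` of an element `a` to the class of `∂ a`
in `I ^ (j + 1) F n / I ^ (j + 2) F n`. -/
def linearPart (F : ChainComplex (ModuleCat.{u} R) ℕ) (hF : IsMinimalFree I F) :
    ChainComplex (ModuleCat.{u} (GrRing I)) ℕ :=
  ChainComplex.of (fun n => ModuleCat.of (GrRing I) (GrModule I (F.X n)))
    (fun n => ModuleCat.ofHom (grShift I (F.d (n + 1) n).hom (hF.range_d_le n)))
    (fun n => by
      refine ModuleCat.hom_ext (LinearMap.ext fun m => ?_)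
      change grShift I _ (hF.range_d_le n) (grShift I _ (hF.range_d_le (n + 1)) m) = 0
      induction m using DirectSum.induction_on with
      | zero => simp only [map_zero]
      | add m m' h h' => rw [map_add, map_add, h, h', add_zero]
      | of i a =>
        obtain ⟨a, rfl⟩ := grMk_surjective I i a
        rw [grShift_of_mk, grShift_of_mk]
        refine (congrArg _ ((grMk_eq_zero_iff I _).2 ?_)).trans (map_zero _)
        have h : (F.d (n + 1) n).hom ((F.d (n + 1 + 1) (n + 1)).hom (a : F.X (n + 1 + 1))) = 0 := by
          rw [← ModuleCat.comp_apply, F.d_comp_d]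
          rfl
        change (F.d (n + 1) n).hom ((F.d (n + 1 + 1) (n + 1)).hom (a : F.X (n + 1 + 1))) ∈ _
        rw [h]
        exact Submodule.zero_mem _)

end LinearPart

section Invariants

/-- The linearity defect of a module `M` over a local ring `R`: the supremum of the degrees `i` with
`H_i(lin F) ≠ 0`, where `F` is a minimal free resolution of `M`. Minimal free resolutions are unique
up to isomorphism of complexes, so all `F` contribute the same set of degrees. The supremum is taken
in the extended real numbers; it is `⊥` if there are no such degrees. -/
def linearityDefect (R : Type u) [CommRing R] [IsLocalRing R] (M : Type u) [AddCommGroup M]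
    [Module R M] : EReal :=
  ⨆ (P : ProjectiveResolution (ModuleCat.of R M))
    (hP : IsMinimalFree (IsLocalRing.maximalIdeal R) P.complex) (i : ℕ)
    (_ : ¬ CategoryTheory.Limits.IsZero
      ((linearPart (IsLocalRing.maximalIdeal R) P.complex hP).homology i)), (i : EReal)

/-- A module over a local ring is Koszul if its linearity defect is zero. -/
def IsKoszul (R : Type u) [CommRing R] [IsLocalRing R] (M : Type u) [AddCommGroup M]
    [Module R M] : Prop :=
  linearityDefect R M = 0

/-- The depth of an ideal `J` on a module `N`: the supremum of the lengths of the `N`-regular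
sequences contained in `J`. Weakly regular sequences are used, that is, `N ≠ (a) N` is not required
of a sequence `a`: this is automatic if `J N ≠ N`, and if `J N = N` with `N` finitely generated, it
gives the usual value `⊤`. -/
def depth {A : Type u} [CommRing A] (J : Ideal A) (N : Type u) [AddCommGroup N] [Module A N] :
    EReal :=
  ⨆ (a : List A) (_ : ∀ r ∈ a, r ∈ J) (_ : RingTheory.Sequence.IsWeaklyRegular N a),
    (a.length : EReal)

end Invariants

end LinDefect

end

/-!
The minimal free resolution of `M / (x) M` is the Koszul complex `K(x) ⊗ F`, where `F` is the minimal
free resolution of `M`, and taking linear parts turns it into `K(x̄) ⊗ lin F`. The whole theorem is a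
comparison of the homology of `lin F` with that of `K(x̄) ⊗ lin F`.

* If `M` is Koszul, then exactness of `lin F` in positive degrees makes the differentials of `F`
  strict for the adic filtrations, so that `lin F` is a resolution of `gr M`
  (`DiffModule.IsResolution.lin`). Hence `K(x̄) ⊗ lin F` computes the Koszul homology of `gr M`, and
  depth sensitivity of Koszul homology (`DiffModule.IsResolution.iSup_eq_sub_depth`) gives the
  formula for the linearity defect.
* If `K(x̄) ⊗ lin F` is exact in some degree for a single element `x`, then `x̄` acts surjectively on
  the homology of `lin F` in this degree, which vanishes by the graded Nakayama lemma
  (`DiffModule.exactAt_lin_of_exactAt_cone`). This gives the ascent of Koszulness, by induction on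
  the length of the sequence.
* If `x̄` is regular on `gr M`, then `x` is regular on `M` by Krull's intersection theorem, and
  `gr (M / x M) = gr M / x̄ gr M` (`nonempty_quotSMulTop_equiv`), so that statements about sequences
  reduce to the case of one element.

Complexes are encoded as `DiffModule`s, single modules with a differential in which the homological
grading is given by projections. That the linearity defect can be read off from any minimal
resolution in this form (`DiffModule.IsResolution.linearityDefect_eq`) follows from the uniqueness
of projective resolutions up to homotopy: homotopies between minimal complexes vanish modulo the
maximal ideal, hence on associated graded modules.
-/

noncomputable section

namespace LinDefect

/-! ### Graded modules with a differential -/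

/-- A chain complex of `A`-modules, encoded as one module `carrier` with an endomorphism `d` of
square zero, where the homological grading is recorded by idempotent endomorphisms `p n`: the
elements of degree `n` are those fixed by `p n`. Compared to a sequence of modules this makes the
degree shift in a mapping cone a matter of reindexing `p`. Neither orthogonality of the `p n` nor a
direct sum decomposition is needed. -/
structure DiffModule (A : Type u) [CommRing A] where
  /-- the underlying module -/
  carrier : Type u
  [addCommGroup : AddCommGroup carrier]
  [module : Module A carrier]
  /-- the differential -/
  d : carrier →ₗ[A] carrier
  /-- the projection to the part of degree `n` -/
  p : ℤ → carrier →ₗ[A] carrier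
  d_d : ∀ v, d (d v) = 0
  p_p : ∀ n v, p n (p n v) = p n v
  d_p : ∀ {m n : ℤ}, m = n + 1 → ∀ v, d (p m v) = p n (d v)
  p_neg : ∀ {n : ℤ}, n < 0 → ∀ v, p n v = 0

namespace DiffModule

open scoped Pointwise

attribute [instance] addCommGroup module

variable {A : Type u} [CommRing A]

/-- Exactness in degree `n`. A primitive `w` of `z` of degree `n + 1` need not be required, since
`p (n + 1) w` is another one. -/
def ExactAt (L : DiffModule A) (n : ℤ) : Prop :=
  ∀ z, L.p n z = z → L.d z = 0 → ∃ w, L.d w = z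

lemma exactAt_of_neg (L : DiffModule A) {n : ℤ} (hn : n < 0) : L.ExactAt n := by
  intro z hz _
  exact ⟨0, by rw [map_zero, ← hz, L.p_neg hn]⟩

lemma ExactAt.exists_deg {L : DiffModule A} {n m : ℤ} (h : L.ExactAt n) (hm : m = n + 1)
    {z : L.carrier} (hz : L.p n z = z) (hdz : L.d z = 0) : ∃ w, L.p m w = w ∧ L.d w = z := by
  obtain ⟨w, rfl⟩ := h z hz hdz
  exact ⟨L.p m w, L.p_p _ _, by rw [L.d_p hm, hz]⟩

/-- Isomorphism of complexes. -/
def Equivalent (L L' : DiffModule A) : Prop :=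
  ∃ e : L.carrier ≃ₗ[A] L'.carrier, (∀ v, e (L.d v) = L'.d (e v)) ∧
    ∀ n v, e (L.p n v) = L'.p n (e v)

namespace Equivalent

variable {L L' L'' : DiffModule A}

lemma refl (L : DiffModule A) : L.Equivalent L := ⟨.refl A _, fun _ => rfl, fun _ _ => rfl⟩

lemma symm : L.Equivalent L' → L'.Equivalent L := by
  rintro ⟨e, hd, hp⟩
  refine ⟨e.symm, fun v => ?_, fun n v => ?_⟩
  · rw [LinearEquiv.symm_apply_eq, hd, LinearEquiv.apply_symm_apply]
  · rw [LinearEquiv.symm_apply_eq, hp, LinearEquiv.apply_symm_apply]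

lemma trans : L.Equivalent L' → L'.Equivalent L'' → L.Equivalent L'' := by
  rintro ⟨e, hd, hp⟩ ⟨f, hd', hp'⟩
  exact ⟨e.trans f, fun v => by simp [hd, hd'], fun n v => by simp [hp, hp']⟩

lemma exactAt (h : L.Equivalent L') {n : ℤ} (hL : L.ExactAt n) : L'.ExactAt n := by
  obtain ⟨e, hd, hp⟩ := h.symm
  intro z hz hdz
  obtain ⟨w, hw⟩ := hL (e z) (by rw [← hp, hz]) (by rw [← hd, hdz, map_zero])
  exact ⟨e.symm w, by rw [← e.injective.eq_iff, hd, e.apply_symm_apply, hw]⟩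

lemma exactAt_iff (h : L.Equivalent L') {n : ℤ} : L.ExactAt n ↔ L'.ExactAt n :=
  ⟨h.exactAt, h.symm.exactAt⟩

end Equivalent

/-! ### Mapping cones and Koszul complexes -/

/-- The mapping cone of the multiplication by `a`. -/
def cone (a : A) (L : DiffModule A) : DiffModule A where
  carrier := L.carrier × L.carrier
  d := (L.d.comp (.fst A _ _) + a • .snd A _ _).prod (-(L.d.comp (.snd A _ _)))
  p n := (L.p n).prodMap (L.p (n - 1))
  d_d v := by simp [L.d_d]
  p_p n v := by simp [L.p_p]
  d_p {m n} h v := Prod.ext (by simp [L.d_p h, show m - 1 = n by omega])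
    (by simp [L.d_p (show m - 1 = n - 1 + 1 by rw [h]; ring)])
  p_neg {n} h v := Prod.ext (L.p_neg h v.1) (L.p_neg (show n - 1 < 0 by omega) v.2)

/-- The element of the mapping cone with components `u` and `v`, the second of which has its degree
raised by one. -/
def coneMk (a : A) {L : DiffModule A} (u v : L.carrier) : (cone a L).carrier := (u, v)

section coneMk

variable {a : A} {L : DiffModule A}

lemma forall_cone {P : (cone a L).carrier → Prop} : (∀ z, P z) ↔ ∀ u v, P (coneMk a u v) :=
  Prod.forall

lemma exists_cone {P : (cone a L).carrier → Prop} : (∃ z, P z) ↔ ∃ u v, P (coneMk a u v) :=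
  Prod.exists

@[simp] lemma coneMk_inj {u v u' v' : L.carrier} :
    coneMk a u v = coneMk a u' v' ↔ u = u' ∧ v = v' :=
  Prod.mk_inj

@[simp] lemma coneMk_eq_zero {u v : L.carrier} : coneMk a u v = 0 ↔ u = 0 ∧ v = 0 :=
  Prod.mk_eq_zero

@[simp] lemma cone_d (u v : L.carrier) :
    (cone a L).d (coneMk a u v) = coneMk a (L.d u + a • v) (-L.d v) := rfl

@[simp] lemma cone_p (n : ℤ) (u v : L.carrier) :
    (cone a L).p n (coneMk a u v) = coneMk a (L.p n u) (L.p (n - 1) v) := rfl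

@[simp] lemma smul_coneMk (b : A) (u v : L.carrier) :
    b • coneMk a u v = coneMk a (b • u) (b • v) := rfl

@[simp] lemma coneMk_add (u v u' v' : L.carrier) :
    coneMk a u v + coneMk a u' v' = coneMk a (u + u') (v + v') := rfl

/-- The projection of the mapping cone to its first component, which does not commute with the
differentials. -/
def coneFst (a : A) (L : DiffModule A) : (cone a L).carrier →ₗ[A] L.carrier := LinearMap.fst A _ _

@[simp] lemma coneFst_coneMk (u v : L.carrier) : coneFst a L (coneMk a u v) = u := rfl

end coneMk

/-- The iterated mapping cone of the multiplications by the elements of a list, that is, the tensor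
product of `L` with the Koszul complex. -/
def koszul : List A → DiffModule A → DiffModule A
  | [], L => L
  | a :: l, L => koszul l (cone a L)

lemma Equivalent.cone {L L' : DiffModule A} (h : L.Equivalent L') (a : A) :
    (L.cone a).Equivalent (L'.cone a) := by
  obtain ⟨e, hd, hp⟩ := h
  refine ⟨e.prodCongr e, forall_cone.2 fun u v => ?_, fun n => forall_cone.2 fun u v => ?_⟩
  · change coneMk a (e (L.d u + a • v)) (e (-L.d v)) =
      (DiffModule.cone a L').d (coneMk a (e u) (e v))
    simp [hd]
  · change coneMk a (e (L.p n u)) (e (L.p (n - 1) v)) =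
      (DiffModule.cone a L').p n (coneMk a (e u) (e v))
    simp [hp]

lemma Equivalent.koszul {L L' : DiffModule A} (h : L.Equivalent L') (l : List A) :
    (koszul l L).Equivalent (koszul l L') := by
  induction l generalizing L L' with
  | nil => exact h
  | cons a l ih => exact ih (h.cone a)

lemma cone_cone_equivalent (a b : A) (L : DiffModule A) :
    ((L.cone b).cone a).Equivalent ((L.cone a).cone b) := by
  let f : ((L.carrier × L.carrier) × (L.carrier × L.carrier)) →ₗ[A]
      (L.carrier × L.carrier) × (L.carrier × L.carrier) :=
    { toFun v := ((v.1.1, v.2.1), (v.1.2, -v.2.2))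
      map_add' _ _ := by ext <;> simp [add_comm]
      map_smul' _ _ := by ext <;> simp }
  refine ⟨LinearEquiv.ofInvolutive f fun v => ?_, ?_, ?_⟩
  · change ((v.1.1, v.1.2), (v.2.1, - -v.2.2)) = v
    rw [neg_neg]
    rfl
  · refine forall_cone.2 (forall_cone.2 fun u v => forall_cone.2 fun s t => ?_)
    change coneMk b (coneMk a (L.d u + b • v + a • s) (-(L.d s + b • t)))
      (coneMk a (- L.d v + a • t) (- - -L.d t)) =
      (cone b (cone a L)).d (coneMk b (coneMk a u s) (coneMk a v (-t)))
    simp only [cone_d, smul_coneMk, coneMk_add, coneMk_inj, map_neg]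
    change _ ∧ coneMk a _ _ = coneMk a (-(L.d v + a • -t)) (- - -L.d t)
    simp only [coneMk_inj, smul_neg]
    refine ⟨⟨by abel, by abel⟩, by abel, trivial⟩
  · refine fun n => forall_cone.2 (forall_cone.2 fun u v => forall_cone.2 fun s t => ?_)
    change coneMk b (coneMk a (L.p n u) (L.p (n - 1) s))
      (coneMk a (L.p (n - 1) v) (-L.p (n - 1 - 1) t)) =
      (cone b (cone a L)).p n (coneMk b (coneMk a u s) (coneMk a v (-t)))
    simp only [cone_p, map_neg]

lemma koszul_cone_equivalent (b : A) (l : List A) (L : DiffModule A) :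
    (koszul l (cone b L)).Equivalent (cone b (koszul l L)) := by
  induction l generalizing L with
  | nil => exact .refl _
  | cons a l ih => exact ((cone_cone_equivalent a b L).koszul l).trans (ih _)

lemma exactAt_cone {L : DiffModule A} (a : A) {n : ℤ} (h : L.ExactAt n)
    (h' : L.ExactAt (n - 1)) : (cone a L).ExactAt n := by
  refine forall_cone.2 fun u v hp hd => ?_
  simp only [cone_p, cone_d, coneMk_inj, coneMk_eq_zero, neg_eq_zero] at hp hd
  obtain ⟨s, hs, rfl⟩ := h'.exists_deg (m := n) (by ring) hp.2 hd.2
  obtain ⟨t, ht⟩ := h (u + a • s) (by rw [map_add, map_smul, hp.1, hs])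
    (by rw [map_add, map_smul, hd.1])
  exact ⟨coneMk a t (-s), by simp [ht]⟩

lemma exactAt_koszul {L : DiffModule A} {e : ℤ} (h : ∀ i, e < i → L.ExactAt i) (l : List A)
    {i : ℤ} (hi : e + l.length < i) : (koszul l L).ExactAt i := by
  induction l generalizing L e with
  | nil => exact h i (by simpa using hi)
  | cons a l ih =>
    refine ih (e := e + 1) (fun j hj => exactAt_cone a (h j (by omega)) (h _ (by omega))) ?_
    simp only [List.length_cons, Nat.cast_add, Nat.cast_one] at hi
    omega

/-- The elements of `A` whose multiplication on `L` is null-homotopic. -/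
def nullIdeal (L : DiffModule A) : Ideal A where
  carrier := {a | ∃ h : L.carrier →ₗ[A] L.carrier, ∀ v, L.d (h v) + h (L.d v) = a • v}
  zero_mem' := ⟨0, by simp⟩
  add_mem' := by
    rintro a b ⟨f, hf⟩ ⟨g, hg⟩
    refine ⟨f + g, fun v => ?_⟩
    rw [add_smul, ← hf, ← hg]
    simp only [LinearMap.add_apply, map_add]
    abel
  smul_mem' := by
    rintro c a ⟨f, hf⟩
    refine ⟨c • f, fun v => ?_⟩
    rw [smul_eq_mul, mul_smul, ← hf]
    simp

lemma mem_nullIdeal_cone (a : A) (L : DiffModule A) : a ∈ (cone a L).nullIdeal := by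
  refine ⟨(LinearMap.inr A L.carrier L.carrier).comp (.fst A _ _), ?_⟩
  refine forall_cone.2 fun u v => ?_
  change (cone a L).d (coneMk a 0 u) + coneMk a 0 (L.d u + a • v) = a • coneMk a u v
  simp

lemma nullIdeal_le_cone (a : A) (L : DiffModule A) : L.nullIdeal ≤ (cone a L).nullIdeal := by
  rintro b ⟨h, hh⟩
  refine ⟨h.prodMap (-h), ?_⟩
  refine forall_cone.2 fun u v => ?_
  change (cone a L).d (coneMk a (h u) (-h v)) + coneMk a (h (L.d u + a • v)) (-h (-L.d v)) =
    b • coneMk a u v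
  simp only [cone_d, coneMk_add, smul_coneMk, coneMk_inj, ← hh, map_add, map_smul, map_neg,
    smul_neg, neg_neg]
  exact ⟨by abel, trivial⟩

lemma nullIdeal_le_koszul (l : List A) (L : DiffModule A) :
    L.nullIdeal ≤ (koszul l L).nullIdeal := by
  induction l generalizing L with
  | nil => exact le_rfl
  | cons a l ih => exact (nullIdeal_le_cone a L).trans (ih _)

lemma ofList_le_nullIdeal_koszul (l : List A) (L : DiffModule A) :
    Ideal.ofList l ≤ (koszul l L).nullIdeal := by
  induction l generalizing L with
  | nil => simp
  | cons a l ih =>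
    rw [Ideal.ofList_cons, sup_le_iff, Ideal.span_singleton_le_iff_mem]
    exact ⟨nullIdeal_le_koszul l _ (mem_nullIdeal_cone a L), ih _⟩

/-- If the multiplication by `a` is null-homotopic, then the long exact homology sequence of the
mapping cone splits into short ones. -/
lemma exactAt_cone_iff {L : DiffModule A} {a : A} (ha : a ∈ L.nullIdeal) {n : ℤ} :
    (cone a L).ExactAt n ↔ L.ExactAt n ∧ L.ExactAt (n - 1) := by
  refine ⟨fun H => ⟨fun z hz hdz => ?_, fun v hv hdv => ?_⟩, fun h => exactAt_cone a h.1 h.2⟩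
  · obtain ⟨h, hh⟩ := ha
    obtain ⟨s, t, hst⟩ := exists_cone.1 (H (coneMk a z 0) (by simp [hz]) (by simp [hdz]))
    simp only [cone_d, coneMk_inj, neg_eq_zero] at hst
    refine ⟨s + h t, ?_⟩
    have := hh t
    rw [hst.2, map_zero, add_zero] at this
    rw [map_add, this, hst.1]
  · obtain ⟨h, hh⟩ := ha
    have hv' := hh v
    rw [hdv, map_zero, add_zero] at hv'
    obtain ⟨s, t, hst⟩ := exists_cone.1 (H (coneMk a (L.p n (-h v)) v) (by simp [L.p_p, hv])
      (by simp [L.d_p (show n = n - 1 + 1 by ring), hv', hv, hdv]))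
    simp only [cone_d, coneMk_inj] at hst
    exact ⟨-t, by simpa using hst.2⟩

/-- If `e` is the top degree in which `L` has homology, then the top homology of the Koszul complex,
in degree `e + l.length`, is the part of the homology of `L` in degree `e` that is killed by `l`. The
lemma is the implication needed here: if the former vanishes, then so does the latter. -/
lemma exists_d_eq_of_exactAt_koszul (l : List A) {L : DiffModule A} {e : ℤ}
    (h : ∀ i, e < i → L.ExactAt i) (hl : (koszul l L).ExactAt (e + l.length)) {z : L.carrier}
    (hz : L.p e z = z) (hdz : L.d z = 0) (ha : ∀ a ∈ l, ∃ w, L.d w = a • z) :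
    ∃ w, L.d w = z := by
  induction l generalizing L e with
  | nil => 
    rw [List.length_nil, Nat.cast_zero, add_zero] at hl
    exact hl z hz hdz
  | cons y l ih =>
    obtain ⟨u, hu⟩ := ha y (by simp)
    have hu' : L.d (-L.p (e + 1) u) = -(y • z) := by rw [map_neg, L.d_p rfl, hu, map_smul, hz]
    obtain ⟨s, t, hst⟩ := exists_cone.1 <| ih (L := cone y L) (e := e + 1)
      (z := coneMk y (-L.p (e + 1) u) z)
      (fun j hj => exactAt_cone y (h j (by omega)) (h _ (by omega)))
      (by
        have : (koszul l (cone y L)).ExactAt _ := hl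
        convert this using 1
        simp only [List.length_cons, Nat.cast_add, Nat.cast_one]
        ring)
      (by simp [L.p_p, hz]) (by rw [cone_d, hu', hdz]; simp) (by
        intro a hal
        obtain ⟨t, ht⟩ := ha a (List.mem_cons_of_mem _ hal)
        have ht' : L.d (L.p (e + 1) t) = a • z := by rw [L.d_p rfl, ht, map_smul, hz]
        obtain ⟨s, hs⟩ := h (e + 1) (by omega) (a • -L.p (e + 1) u + y • L.p (e + 1) t)
          (by simp [L.p_p]) (by
            rw [map_add, map_smul, map_smul, hu', ht', smul_neg, smul_comm, neg_add_cancel])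
        exact ⟨coneMk y s (-L.p (e + 1) t), by simp [hs, ht']⟩)
    simp only [cone_d, coneMk_inj] at hst
    exact ⟨-t, by simpa using hst.2⟩

lemma mem_range_sup_of_exactAt_koszul_zero (l : List A) {L : DiffModule A}
    (hl : (koszul l L).ExactAt 0) {z : L.carrier} (hz : L.p 0 z = z) (hdz : L.d z = 0) :
    z ∈ LinearMap.range L.d ⊔ Ideal.ofList l • (⊤ : Submodule A L.carrier) := by
  induction l generalizing L with
  | nil =>
    obtain ⟨w, rfl⟩ := hl z hz hdz
    exact Submodule.mem_sup_left ⟨w, rfl⟩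
  | cons y l ih =>
    have := ih (L := cone y L) hl (z := coneMk y z 0) (by simp [hz]) (by simp [hdz])
    obtain ⟨_, ⟨w, rfl⟩, j, hj, hst⟩ := Submodule.mem_sup.1 this
    revert w
    refine forall_cone.2 fun s t hst => ?_
    have hj' := Submodule.mem_map_of_mem (f := coneFst y L) hj
    rw [Submodule.map_smul''] at hj'
    have hst1 := congrArg (coneFst y L) hst
    rw [map_add, cone_d, coneFst_coneMk, coneFst_coneMk] at hst1
    rw [← hst1, add_assoc]
    refine Submodule.add_mem_sup ⟨s, rfl⟩ (Submodule.add_mem _ ?_ ?_)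
    · exact Submodule.smul_mem_smul
        (Ideal.subset_span (by simp)) trivial
    · refine Submodule.smul_mono ?_ le_top hj'
      rw [Ideal.ofList_cons]
      exact le_sup_right

/-! ### Resolutions -/

/-- The map `π` makes `L` a resolution of `N`. -/
structure IsResolution {N : Type u} [AddCommGroup N] [Module A N] (L : DiffModule A)
    (π : L.carrier →ₗ[A] N) : Prop where
  surjective : Function.Surjective π
  map_p (v : L.carrier) : π (L.p 0 v) = π v
  map_d (v : L.carrier) : π (L.d v) = 0
  exact_zero (z : L.carrier) : L.p 0 z = z → π z = 0 → ∃ w, L.d w = z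
  exactAt (n : ℤ) : 0 < n → L.ExactAt n

lemma d_of_deg_zero (L : DiffModule A) {z : L.carrier} (hz : L.p 0 z = z) : L.d z = 0 := by
  rw [← hz, L.d_p (show (0 : ℤ) = -1 + 1 by norm_num), L.p_neg (by norm_num)]

namespace IsResolution

variable {N N' : Type u} [AddCommGroup N] [Module A N] [AddCommGroup N'] [Module A N']
  {L L' : DiffModule A} {π : L.carrier →ₗ[A] N}

lemma comp_equiv (h : L.IsResolution π) (e : N ≃ₗ[A] N') : L.IsResolution (e.toLinearMap ∘ₗ π) where
  surjective := e.surjective.comp h.surjective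
  map_p v := by simp [h.map_p]
  map_d v := by simp [h.map_d]
  exact_zero z hz hz' := h.exact_zero z hz (by simpa using hz')
  exactAt := h.exactAt

/-- The mapping cone of the multiplication by a nonzerodivisor `y` on `N` resolves `N / y N`. -/
lemma cone (h : L.IsResolution π) {y : A} (hy : IsSMulRegular N y) :
    (L.cone y).IsResolution
      ((Submodule.mkQ (y • (⊤ : Submodule A N))) ∘ₗ π ∘ₗ coneFst y L) where
  surjective := (Submodule.mkQ_surjective _).comp (h.surjective.comp Prod.fst_surjective)
  map_p := forall_cone.2 fun u v => by simp [h.map_p]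
  map_d := forall_cone.2 fun u v => by
    change Submodule.mkQ _ (π (L.d u + y • v)) = 0
    rw [map_add, h.map_d, zero_add, map_smul, Submodule.mkQ_apply, Submodule.Quotient.mk_eq_zero]
    exact Submodule.smul_mem_pointwise_smul _ _ _ trivial
  exact_zero := forall_cone.2 fun u v huv hu => by
    change Submodule.mkQ _ (π u) = 0 at hu
    rw [Submodule.mkQ_apply, Submodule.Quotient.mk_eq_zero,
      Submodule.mem_smul_pointwise_iff_exists] at hu
    simp only [cone_p, coneMk_inj] at huv
    obtain ⟨n, -, hn⟩ := hu
    obtain ⟨t, rfl⟩ := h.surjective n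
    obtain ⟨s, hs⟩ := h.exact_zero (u - y • L.p 0 t) (by simp [L.p_p, huv.1])
      (by simp [h.map_p, hn])
    refine ⟨coneMk y s (L.p 0 t), ?_⟩
    rw [L.p_neg (show (0 - 1 : ℤ) < 0 by norm_num)] at huv
    rw [cone_d, hs, L.d_of_deg_zero (L.p_p _ _), ← huv.2]
    simp
  exactAt n hn := by
    by_cases hn1 : n = 1
    · subst hn1
      refine forall_cone.2 fun u v hp hd => ?_
      simp only [cone_p, cone_d, coneMk_inj, coneMk_eq_zero, neg_eq_zero] at hp hd
      have hp2 : L.p 0 v = v := hp.2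
      obtain ⟨w, hw⟩ := h.exact_zero v hp2 (hy (by
        change y • π v = y • 0
        have hπ := congrArg π hd.1
        rwa [map_add, h.map_d, zero_add, map_smul, map_zero, ← smul_zero y] at hπ))
      have hw' : L.d (L.p 1 w) = v := by rw [L.d_p (show (1 : ℤ) = 0 + 1 by norm_num), hw, hp2]
      obtain ⟨t, ht⟩ := h.exactAt 1 one_pos (u + y • L.p 1 w) (by simp [L.p_p, hp.1])
        (by rw [map_add, map_smul, hw', hd.1])
      exact ⟨coneMk y t (-L.p 1 w), by simp [ht, hw']⟩
    · exact exactAt_cone y (h.exactAt n hn) (h.exactAt _ (by omega))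

end IsResolution

/-- The homology in degree one of the mapping cone of the multiplication by `y` on a resolution of
`N` is the kernel of the multiplication by `y` on `N`. -/
lemma IsResolution.isSMulRegular {N : Type u} [AddCommGroup N] [Module A N] {L : DiffModule A}
    {π : L.carrier →ₗ[A] N} (h : L.IsResolution π) {y : A} (h1 : (L.cone y).ExactAt 1) :
    IsSMulRegular N y := by
  rw [isSMulRegular_iff_right_eq_zero_of_smul]
  intro n hn
  obtain ⟨v, rfl⟩ := h.surjective n
  rw [← h.map_p, ← map_smul] at hn
  obtain ⟨u, hu⟩ := h.exact_zero _ (by simp [L.p_p]) hn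
  have hu' : L.d (L.p 1 u) = y • L.p 0 v := by
    rw [L.d_p (show (1 : ℤ) = 0 + 1 by norm_num), hu, map_smul, L.p_p]
  obtain ⟨s, t, hst⟩ := exists_cone.1 (h1 (coneMk y (-L.p 1 u) (L.p 0 v)) (by simp [L.p_p])
    (by simp [hu', L.d_of_deg_zero (L.p_p 0 v)]))
  simp only [cone_d, coneMk_inj] at hst
  rw [← h.map_p, ← hst.2, map_neg, h.map_d, neg_zero]

end DiffModule

/-! ### Depth sensitivity of Koszul homology -/

namespace DiffModule

open RingTheory.Sequence
open scoped Pointwise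

variable {A : Type u} [CommRing A]

/-- If `b` is a weakly regular sequence on `N` consisting of elements of the ideal generated by `l`,
then the Koszul homology of `N` vanishes in the `b.length` highest degrees. -/
lemma IsResolution.add_length_le (l b : List A) (hb : ∀ r ∈ b, r ∈ Ideal.ofList l) {N : Type u}
    [AddCommGroup N] [Module A N] (hbN : IsWeaklyRegular N b) {L : DiffModule A}
    {π : L.carrier →ₗ[A] N} (h : L.IsResolution π) {i : ℤ} (hi : ¬ (koszul l L).ExactAt i) :
    i + b.length ≤ l.length := by
  induction b generalizing N L i with
  | nil =>
    by_contra hlt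
    exact hi (exactAt_koszul h.exactAt l (by simpa using hlt))
  | cons y b ih =>
    rw [isWeaklyRegular_cons_iff] at hbN
    have := ih (fun r hr => hb r (List.mem_cons_of_mem _ hr)) hbN.2 (h.cone hbN.1) (i := i + 1) (by
      rw [(koszul_cone_equivalent y l L).exactAt_iff, exactAt_cone_iff
        (ofList_le_nullIdeal_koszul l L (hb y (by simp)))]
      rw [add_sub_cancel_right]
      exact fun H => hi H.2)
    simp only [List.length_cons, Nat.cast_add, Nat.cast_one]
    omega

/-- An ideal of a noetherian ring that annihilates no nonzero element of a finitely generated module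
contains a nonzerodivisor on that module. -/
lemma exists_isSMulRegular [IsNoetherianRing A] (J : Ideal A) (N : Type u) [AddCommGroup N]
    [Module A N] [Module.Finite A N] (h : ∀ n : N, (∀ a ∈ J, a • n = 0) → n = 0) :
    ∃ y ∈ J, IsSMulRegular N y := by
  by_contra! H
  have hJ : (J : Set A) ⊆ ⋃ P ∈ associatedPrimes A N, (id P : Ideal A) := by
    intro y hy
    have h1 := biUnion_associatedPrimes_eq_zero_divisors A N
    simp only [id]
    rw [h1]
    have := H y hy
    rw [isSMulRegular_iff_right_eq_zero_of_smul] at this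
    push Not at this
    obtain ⟨n, hn, hn0⟩ := this
    exact ⟨n, hn0, hn⟩
  obtain ⟨P, hP, hJP⟩ := (J.subset_union_prime_finite (associatedPrimes.finite A N) (f := id) 0 0
    fun _ h _ _ => h.isPrime).1 hJ
  rw [AssociatedPrimes.mem_iff, isAssociatedPrime_iff] at hP
  obtain ⟨prime, n, rfl⟩ := hP
  refine prime.ne_top ?_
  rw [h n fun a ha => by simpa using hJP ha]
  simp

/-- If `i` is the highest degree with nonvanishing Koszul homology, then there is a weakly regular
sequence of length `l.length - i` in the ideal generated by `l`. -/
lemma IsResolution.exists_isWeaklyRegular [IsNoetherianRing A] (l : List A) (k : ℕ) {N : Type u}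
    [AddCommGroup N] [Module A N] [Module.Finite A N] {L : DiffModule A}
    {π : L.carrier →ₗ[A] N} (h : L.IsResolution π) {i : ℤ} (hi : ¬ (koszul l L).ExactAt i)
    (hi' : ∀ j, i < j → (koszul l L).ExactAt j) (hk : i + k = l.length) :
    ∃ b : List A, b.length = k ∧ (∀ r ∈ b, r ∈ Ideal.ofList l) ∧ IsWeaklyRegular N b := by
  induction k generalizing N L i with
  | zero => exact ⟨[], rfl, by simp, by simp⟩
  | succ k ih =>
    -- The elements of `N` killed by `l` are the Koszul homology in degree `l.length > i`.
    obtain ⟨y, hyl, hy⟩ := exists_isSMulRegular (Ideal.ofList l) N (by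
      intro n hn
      obtain ⟨v, rfl⟩ := h.surjective n
      obtain ⟨w, hw⟩ := exists_d_eq_of_exactAt_koszul l (L := L) (e := 0) (z := L.p 0 v) h.exactAt
        (by rw [zero_add]; exact hi' _ (by omega)) (L.p_p _ _) (L.d_of_deg_zero (L.p_p _ _)) (by
          intro a ha
          refine h.exact_zero _ (by simp [L.p_p]) ?_
          rw [map_smul, h.map_p]
          exact hn a (Ideal.subset_span ha))
      rw [← h.map_p, ← hw, h.map_d])
    have key (j : ℤ) : (koszul l (L.cone y)).ExactAt j ↔
        (koszul l L).ExactAt j ∧ (koszul l L).ExactAt (j - 1) := by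
      rw [(koszul_cone_equivalent y l L).exactAt_iff, exactAt_cone_iff
        (ofList_le_nullIdeal_koszul l L hyl)]
    obtain ⟨b, hbk, hbl, hb⟩ := ih (h.cone hy) (i := i + 1)
      (by rw [key, add_sub_cancel_right]; exact fun H => hi H.2)
      (fun j hj => (key j).2 ⟨hi' _ (by omega), hi' _ (by omega)⟩) (by push_cast at hk; omega)
    refine ⟨y :: b, by simp [hbk], ?_, (isWeaklyRegular_cons_iff ..).2 ⟨hy, hb⟩⟩
    intro r hr
    rcases List.mem_cons.1 hr with rfl | hr
    exacts [hyl, hbl r hr]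

/-- Depth sensitivity: the highest degree with nonvanishing Koszul homology is the number of
elements minus the depth. -/
theorem IsResolution.iSup_eq_sub_depth [IsNoetherianRing A] (l : List A) {N : Type u}
    [AddCommGroup N] [Module A N] [Module.Finite A N] {L : DiffModule A}
    {π : L.carrier →ₗ[A] N} (h : L.IsResolution π)
    (hN : Ideal.ofList l • (⊤ : Submodule A N) ≠ ⊤) :
    (⨆ (i : ℕ) (_ : ¬ (koszul l L).ExactAt i), (i : EReal)) =
      (l.length : EReal) - depth (Ideal.ofList l) N := by
  have h0 : ¬ (koszul l L).ExactAt (0 : ℕ) := by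
    intro H
    refine hN (eq_top_iff.2 fun n _ => ?_)
    obtain ⟨v, rfl⟩ := h.surjective n
    obtain ⟨_, ⟨w, rfl⟩, j, hj, hz⟩ := Submodule.mem_sup.1 (mem_range_sup_of_exactAt_koszul_zero l H
      (L.p_p 0 v) (L.d_of_deg_zero (L.p_p _ _)))
    rw [← h.map_p, ← hz, map_add, h.map_d, zero_add]
    have := Submodule.mem_map_of_mem (f := π) hj
    rw [Submodule.map_smul''] at this
    exact Submodule.smul_mono le_rfl le_top this
  have hbdd (i : ℕ) (hi : ¬ (koszul l L).ExactAt i) : i ≤ l.length := by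
    have := h.add_length_le l [] (by simp) (by simp) hi
    simpa using this
  classical
  obtain ⟨s, hs, hs'⟩ : ∃ s : ℕ, ¬ (koszul l L).ExactAt s ∧
      ∀ i : ℕ, ¬ (koszul l L).ExactAt i → i ≤ s :=
    ⟨Nat.findGreatest (fun i => ¬ (koszul l L).ExactAt i) l.length,
      Nat.findGreatest_spec (P := fun i => ¬ (koszul l L).ExactAt i) (Nat.zero_le _) h0,
      fun i hi => Nat.le_findGreatest (hbdd i hi) hi⟩
  obtain ⟨k, hk⟩ := Nat.exists_eq_add_of_le (hbdd s hs)
  have hdepth : depth (Ideal.ofList l) N = (k : EReal) := by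
    refine le_antisymm (iSup_le fun b => iSup_le fun hb => iSup_le fun hbN => ?_) ?_
    · have := h.add_length_le l b hb hbN hs
      exact_mod_cast (show b.length ≤ k by omega)
    · obtain ⟨b, rfl, hbl, hb⟩ := h.exists_isWeaklyRegular l k hs (fun j hj => by
        by_contra hj'
        have := hs' j.toNat (by rwa [Int.toNat_of_nonneg (by omega)])
        omega) (by omega)
      exact le_iSup_of_le b (le_iSup_of_le hbl (le_iSup_of_le hb le_rfl))
  have hsup : (⨆ (i : ℕ) (_ : ¬ (koszul l L).ExactAt i), (i : EReal)) = s :=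
    le_antisymm (iSup_le fun i => iSup_le fun hi => by exact_mod_cast hs' i hi)
      (le_iSup_of_le s (le_iSup_of_le hs le_rfl))
  rw [hsup, hdepth, hk]
  push_cast
  exact (EReal.add_sub_cancel_right (a := (s : EReal)) (b := (k : ℝ))).symm

end DiffModule

/-! ### Functoriality of associated graded modules -/

section Gr

variable {R : Type u} [CommRing R] (I : Ideal R)
variable {M N P : Type u} [AddCommGroup M] [Module R M] [AddCommGroup N] [Module R N]
  [AddCommGroup P] [Module R P]

/-- The class of `a ∈ I ^ n M` in the component of degree `n` of the associated graded module. -/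
def symb (n : ℕ) (a : M) (ha : a ∈ (I ^ n • ⊤ : Submodule R M)) : GrModule I M :=
  DirectSum.of (GrPiece I M) n (grMk I M n ⟨a, ha⟩)

lemma symb_eq_zero_iff {n : ℕ} {a : M} (ha : a ∈ (I ^ n • ⊤ : Submodule R M)) :
    symb I n a ha = 0 ↔ a ∈ (I ^ (n + 1) • ⊤ : Submodule R M) := by
  rw [symb, ← map_zero (DirectSum.of (GrPiece I M) n), (DirectSum.of_injective n).eq_iff,
    grMk_eq_zero_iff]

lemma symb_add {n : ℕ} {a b : M} (ha : a ∈ (I ^ n • ⊤ : Submodule R M))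
    (hb : b ∈ (I ^ n • ⊤ : Submodule R M)) :
    symb I n (a + b) (add_mem ha hb) = symb I n a ha + symb I n b hb := by
  rw [symb, symb, symb, ← map_add, ← map_add]
  rfl

lemma symb_eq_symb_iff {n : ℕ} {a b : M} (ha : a ∈ (I ^ n • ⊤ : Submodule R M))
    (hb : b ∈ (I ^ n • ⊤ : Submodule R M)) :
    symb I n a ha = symb I n b hb ↔ a - b ∈ (I ^ (n + 1) • ⊤ : Submodule R M) := by
  rw [← symb_eq_zero_iff I (sub_mem ha hb), ← sub_eq_zero, symb, symb, symb, ← map_sub, ← map_sub]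
  rfl

lemma exists_symb (n : ℕ) (ξ : GrPiece I M n) :
    ∃ (a : M) (ha : a ∈ (I ^ n • ⊤ : Submodule R M)),
      DirectSum.of (GrPiece I M) n ξ = symb I n a ha := by
  obtain ⟨a, rfl⟩ := grMk_surjective I n ξ
  exact ⟨a, a.2, rfl⟩

lemma symb_smul_symb {i j : ℕ} {a : R} {b : M} (ha : a ∈ (I ^ i • ⊤ : Submodule R R))
    (hb : b ∈ (I ^ j • ⊤ : Submodule R M)) :
    (symb I i a ha : GrRing I) • symb I j b hb = symb I (i + j) (a • b) (smul_mem_pow I M ha hb) :=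
  DirectSum.Gmodule.of_smul_of _ _ _ _

lemma symb_mul_symb {i j : ℕ} {a b : R} (ha : a ∈ (I ^ i • ⊤ : Submodule R R))
    (hb : b ∈ (I ^ j • ⊤ : Submodule R R)) :
    (symb I i a ha * symb I j b hb : GrRing I) =
      symb I (i + j) (a * b) (smul_mem_pow I R ha hb) :=
  DirectSum.of_mul_of _ _

lemma symb_congr {m n : ℕ} (h : m = n) {a : M} (ha : a ∈ (I ^ m • ⊤ : Submodule R M)) :
    symb I m a ha = symb I n a (h ▸ ha) := by
  subst h
  rfl

lemma mem_pow_succ_of_smul (x : I) {n : ℕ} {a : M} (ha : a ∈ (I ^ n • ⊤ : Submodule R M)) :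
    (x : R) • a ∈ (I ^ (n + 1) • ⊤ : Submodule R M) := by
  rw [add_comm]
  exact smul_mem_pow I M (by simp) ha

lemma degreeOneClass_smul_symb (x : I) {n : ℕ} {a : M} (ha : a ∈ (I ^ n • ⊤ : Submodule R M)) :
    degreeOneClass I x • symb I n a ha = symb I (n + 1) ((x : R) • a) (mem_pow_succ_of_smul I x ha) :=
  (symb_smul_symb I _ ha).trans (symb_congr I (add_comm 1 n) _)

lemma gr_induction {p : GrModule I M → Prop} (ξ : GrModule I M) (h0 : p 0)
    (hadd : ∀ ξ η, p ξ → p η → p (ξ + η)) (h : ∀ n a ha, p (symb I n a ha)) : p ξ := by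
  induction ξ using DirectSum.induction_on with
  | zero => exact h0
  | add ξ η hξ hη => exact hadd _ _ hξ hη
  | of i a =>
    obtain ⟨a, rfl⟩ := grMk_surjective I i a
    exact h i a a.2

lemma gr_hom_ext {X : Type u} [AddCommGroup X] [Module (GrRing I) X]
    {f g : GrModule I M →ₗ[GrRing I] X} (h : ∀ n a ha, f (symb I n a ha) = g (symb I n a ha)) :
    f = g := by
  ext ξ
  induction ξ using gr_induction with
  | h0 => rw [map_zero, map_zero]
  | hadd ξ η hξ hη => rw [map_add, map_add, hξ, hη]
  | h n a ha => exact h n a ha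

lemma map_mem_smul_top (J : Ideal R) (f : M →ₗ[R] N) {a : M}
    (ha : a ∈ (J • ⊤ : Submodule R M)) : f a ∈ (J • ⊤ : Submodule R N) := by
  have h := Submodule.mem_map_of_mem (f := f) ha
  rw [Submodule.map_smul''] at h
  exact Submodule.smul_mono le_rfl le_top h

/-- The map `I ^ n M / I ^ (n + 1) M → I ^ n N / I ^ (n + 1) N` induced by a linear map. -/
def grPieceMap (f : M →ₗ[R] N) (n : ℕ) : GrPiece I M n →ₗ[R] GrPiece I N n :=
  Submodule.liftQ _ ((grMk I N n).comp (f.restrict fun _ ha => map_mem_smul_top (I ^ n) f ha))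
    (fun a ha => (grMk_eq_zero_iff I _).2
      (map_mem_smul_top _ f (show (a : M) ∈ (I ^ (n + 1) • ⊤ : Submodule R M) from ha)))

/-- The homogeneous map of degree zero between associated graded modules which is induced by a
linear map. -/
def grMap (f : M →ₗ[R] N) : GrModule I M →ₗ[GrRing I] GrModule I N where
  __ := DirectSum.toAddMonoid fun n =>
    (DirectSum.of (GrPiece I N) n).comp (grPieceMap I f n).toAddMonoidHom
  map_smul' r m := by
    simp only [ZeroHom.toFun_eq_coe, AddMonoidHom.toZeroHom_coe, RingHom.id_apply]
    induction r using DirectSum.induction_on with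
    | zero => simp only [zero_smul, map_zero]
    | add r s hr hs => simp only [add_smul, map_add, hr, hs]
    | of i a =>
      induction m using DirectSum.induction_on with
      | zero => simp only [smul_zero, map_zero]
      | add m n hm hn => simp only [smul_add, map_add, hm, hn]
      | of j b =>
        obtain ⟨a, rfl⟩ := grMk_surjective I i a
        obtain ⟨b, rfl⟩ := grMk_surjective I j b
        rw [DirectSum.Gmodule.of_smul_of, DirectSum.toAddMonoid_of, DirectSum.toAddMonoid_of]
        refine Eq.trans ?_ (DirectSum.Gmodule.of_smul_of _ _ _ _).symm
        exact DirectSum.of_eq_of_gradedMonoid_eq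
          (grMk_congr I rfl _ _ (map_smul f (a : R) (b : M)))

lemma grMap_symb (f : M →ₗ[R] N) {n : ℕ} {a : M} (ha : a ∈ (I ^ n • ⊤ : Submodule R M)) :
    grMap I f (symb I n a ha) = symb I n (f a) (map_mem_smul_top _ f ha) :=
  DirectSum.toAddMonoid_of _ _ _

lemma grShift_symb (f : M →ₗ[R] N) (hf : LinearMap.range f ≤ I • ⊤) {n : ℕ} {a : M}
    (ha : a ∈ (I ^ n • ⊤ : Submodule R M)) :
    grShift I f hf (symb I n a ha) = symb I (n + 1) (f a) (map_mem_pow_succ I f hf ha) :=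
  grShift_of_mk I f hf n ⟨a, ha⟩

lemma grMap_grMap (g : N →ₗ[R] P) (f : M →ₗ[R] N) (ξ : GrModule I M) :
    grMap I g (grMap I f ξ) = grMap I (g ∘ₗ f) ξ := by
  rw [← LinearMap.comp_apply]
  congr 1
  exact gr_hom_ext I fun n a ha => by simp [grMap_symb]

/-- A map that is congruent to the identity modulo `I` induces the identity. -/
lemma grMap_eq_self {f : M →ₗ[R] M} (hf : ∀ a, f a - a ∈ (I • ⊤ : Submodule R M))
    (ξ : GrModule I M) : grMap I f ξ = ξ := by
  rw [← LinearMap.id_apply (R := GrRing I) ξ, ← LinearMap.comp_apply]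
  congr 1
  refine gr_hom_ext I fun n a ha => ?_
  rw [LinearMap.comp_apply, LinearMap.id_apply, grMap_symb, symb_eq_symb_iff]
  exact map_mem_pow_succ I (f - .id) (by rintro _ ⟨a, rfl⟩; exact hf a) ha

lemma grMap_id (ξ : GrModule I M) : grMap I (.id : M →ₗ[R] M) ξ = ξ :=
  grMap_eq_self I (by simp) ξ

/-- The projection of an associated graded module onto the component of degree `n`. -/
def grComp (n : ℕ) : GrModule I M →+ GrModule I M :=
  (DirectSum.of (GrPiece I M) n).comp (DFinsupp.evalAddMonoidHom n)

lemma grComp_symb_self {n : ℕ} {a : M} (ha : a ∈ (I ^ n • ⊤ : Submodule R M)) :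
    grComp I n (symb I n a ha) = symb I n a ha :=
  congrArg (DirectSum.of (GrPiece I M) n) (DirectSum.of_eq_same _ _)

lemma grComp_symb_of_ne {m n : ℕ} (h : n ≠ m) {a : M} (ha : a ∈ (I ^ n • ⊤ : Submodule R M)) :
    grComp I m (symb I n a ha) = 0 :=
  (congrArg (DirectSum.of (GrPiece I M) m) (DirectSum.of_eq_of_ne _ _ _ h.symm)).trans (map_zero _)

lemma grComp_grComp (n : ℕ) (ξ : GrModule I M) : grComp I n (grComp I n ξ) = grComp I n ξ :=
  congrArg (DirectSum.of (GrPiece I M) n) (DirectSum.of_eq_same _ _)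

lemma exists_grComp_eq_symb (n : ℕ) (ξ : GrModule I M) :
    ∃ (a : M) (ha : a ∈ (I ^ n • ⊤ : Submodule R M)), grComp I n ξ = symb I n a ha :=
  exists_symb I n (ξ n)

lemma exists_eq_sum_grComp (ξ : GrModule I M) : ∃ s : Finset ℕ, ξ = ∑ n ∈ s, grComp I n ξ := by
  classical
  exact ⟨DFinsupp.support ξ, (DirectSum.sum_support_of ξ).symm⟩

lemma grComp_grMap (f : M →ₗ[R] N) (n : ℕ) (ξ : GrModule I M) :
    grComp I n (grMap I f ξ) = grMap I f (grComp I n ξ) := by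
  induction ξ using gr_induction with
  | h0 => simp only [map_zero]
  | hadd ξ η hξ hη => simp only [map_add, hξ, hη]
  | h m a ha =>
    rw [grMap_symb]
    by_cases h : m = n
    · subst h
      rw [grComp_symb_self, grComp_symb_self, grMap_symb]
    · rw [grComp_symb_of_ne I h, grComp_symb_of_ne I h, map_zero]

lemma grComp_grShift_succ (f : M →ₗ[R] N) (hf : LinearMap.range f ≤ I • ⊤) (n : ℕ)
    (ξ : GrModule I M) : grComp I (n + 1) (grShift I f hf ξ) = grShift I f hf (grComp I n ξ) := by
  induction ξ using gr_induction with
  | h0 => simp only [map_zero]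
  | hadd ξ η hξ hη => simp only [map_add, hξ, hη]
  | h m a ha =>
    rw [grShift_symb]
    by_cases h : m = n
    · subst h
      rw [grComp_symb_self, grComp_symb_self, grShift_symb]
    · rw [grComp_symb_of_ne I (by omega), grComp_symb_of_ne I h, map_zero]

lemma grComp_grShift_zero (f : M →ₗ[R] N) (hf : LinearMap.range f ≤ I • ⊤) (ξ : GrModule I M) :
    grComp I 0 (grShift I f hf ξ) = 0 := by
  induction ξ using gr_induction with
  | h0 => simp only [map_zero]
  | hadd ξ η hξ hη => simp only [map_add, hξ, hη, add_zero]
  | h m a ha => rw [grShift_symb, grComp_symb_of_ne I (by omega)]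

lemma grComp_degreeOneClass_smul_succ (x : I) (n : ℕ) (ξ : GrModule I M) :
    grComp I (n + 1) (degreeOneClass I x • ξ) = degreeOneClass I x • grComp I n ξ := by
  induction ξ using gr_induction with
  | h0 => simp only [smul_zero, map_zero]
  | hadd ξ η hξ hη => simp only [smul_add, map_add, hξ, hη]
  | h m a ha =>
    rw [degreeOneClass_smul_symb]
    by_cases h : m = n
    · subst h
      rw [grComp_symb_self, grComp_symb_self, degreeOneClass_smul_symb]
    · rw [grComp_symb_of_ne I (by omega), grComp_symb_of_ne I h, smul_zero]

lemma grComp_degreeOneClass_smul_zero (x : I) (ξ : GrModule I M) :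
    grComp I 0 (degreeOneClass I x • ξ) = 0 := by
  induction ξ using gr_induction with
  | h0 => simp only [smul_zero, map_zero]
  | hadd ξ η hξ hη => simp only [smul_add, map_add, hξ, hη, add_zero]
  | h m a ha => rw [degreeOneClass_smul_symb, grComp_symb_of_ne I (by omega)]

lemma grMap_surjective {f : M →ₗ[R] N} (hf : Function.Surjective f) :
    Function.Surjective (grMap I f) := by
  intro ξ
  induction ξ using gr_induction with
  | h0 => exact ⟨0, map_zero _⟩
  | hadd ξ η hξ hη =>
    obtain ⟨ξ, rfl⟩ := hξ
    obtain ⟨η, rfl⟩ := hη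
    exact ⟨ξ + η, map_add _ _ _⟩
  | h n a ha =>
    have h : a ∈ Submodule.map f (I ^ n • ⊤) := by
      rwa [Submodule.map_smul'', Submodule.map_top, LinearMap.range_eq_top.2 hf]
    obtain ⟨b, hb, rfl⟩ := h
    exact ⟨symb I n b hb, grMap_symb I f hb⟩

/-! ### Finiteness of associated graded rings and modules -/

/-- The ring homomorphism from `R` to the component of degree zero of its associated graded ring. -/
def grAlgebraMap : R →+* GrRing I where
  toFun r := symb I 0 r (mem_pow_zero_smul_top I R r)
  map_one' := rfl
  map_mul' _ _ := ((symb_mul_symb I _ _).trans (symb_congr I (add_zero 0) _)).symm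
  map_zero' := (symb_eq_zero_iff I _).2 (zero_mem _)
  map_add' _ _ := symb_add I _ _

instance [IsNoetherianRing R] : IsNoetherianRing (GrRing I) := by
  obtain ⟨n, g, hg⟩ := Submodule.fg_iff_exists_fin_generating_family.1 (IsNoetherian.noetherian I)
  have hgI (i : Fin n) : g i ∈ I := hg ▸ Submodule.subset_span ⟨i, rfl⟩
  -- The associated graded ring is a quotient of a polynomial ring over `R`.
  let φ : MvPolynomial (Fin n) R →+* GrRing I :=
    MvPolynomial.eval₂Hom (grAlgebraMap I) fun i => degreeOneClass I ⟨g i, hgI i⟩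
  have h0 (r : R) : symb I 0 r (mem_pow_zero_smul_top I R r) ∈ φ.range :=
    ⟨MvPolynomial.C r, MvPolynomial.eval₂Hom_C _ _ _⟩
  have h1 (x : R) (hx : x ∈ I) : (symb I 1 x (by simpa using hx) : GrRing I) ∈ φ.range := by
    have hx' : x ∈ Submodule.span R (Set.range g) := hg ▸ hx
    induction hx' using Submodule.span_induction with
    | mem x h =>
      obtain ⟨i, rfl⟩ := h
      exact ⟨MvPolynomial.X i, MvPolynomial.eval₂Hom_X' _ _ _⟩
    | zero =>
      rw [(symb_eq_zero_iff I _).2 (zero_mem _)]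
      exact zero_mem _
    | add x y hx' hy' h h' =>
      have hx'' : x ∈ I := hg ▸ hx'
      have hy'' : y ∈ I := hg ▸ hy'
      rw [symb_add I (by simpa using hx'') (by simpa using hy'')]
      exact add_mem (h hx'') (h' hy'')
    | smul r x hx' h =>
      have hx'' : x ∈ I := hg ▸ hx'
      have := mul_mem (h0 r) (h hx'')
      rw [symb_mul_symb, symb_congr I (zero_add 1)] at this
      exact this
  have hn (n : ℕ) : ∀ (a : R) (ha : a ∈ (I ^ n • ⊤ : Submodule R R)),
      (symb I n a ha : GrRing I) ∈ φ.range := by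
    induction n with
    | zero => exact fun a _ => h0 a
    | succ n ih =>
      intro a ha
      have ha' : a ∈ I * I ^ n := by rw [← pow_succ']; simpa using ha
      induction ha' using Submodule.mul_induction_on' with
      | mem_mul_mem x hx y hy =>
        have := mul_mem (h1 x hx) (ih y (by simpa using hy))
        rw [symb_mul_symb, symb_congr I (add_comm 1 n)] at this
        exact this
      | add x hx y hy h h' =>
        have hx' : x ∈ (I ^ (n + 1) • ⊤ : Submodule R R) := by rw [pow_succ']; simpa using hx
        have hy' : y ∈ (I ^ (n + 1) • ⊤ : Submodule R R) := by rw [pow_succ']; simpa using hy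
        rw [symb_add I hx' hy']
        exact add_mem (h hx') (h' hy')
  refine isNoetherianRing_of_surjective _ _ φ fun ξ => ?_
  change ξ ∈ φ.range
  induction ξ using gr_induction with
  | h0 => exact zero_mem _
  | hadd ξ η hξ hη => exact add_mem hξ hη
  | h n a ha => exact hn n a ha

instance [Module.Finite R M] : Module.Finite (GrRing I) (GrModule I M) := by
  obtain ⟨n, g, hg⟩ := Submodule.fg_iff_exists_fin_generating_family.1
    (Module.Finite.fg_top (R := R) (M := M))
  refine ⟨Submodule.fg_iff_exists_fin_generating_family.2
    ⟨n, fun i => symb I 0 (g i) (mem_pow_zero_smul_top I M _), ?_⟩⟩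
  set S := Submodule.span (GrRing I)
    (Set.range fun i => symb I 0 (g i) (mem_pow_zero_smul_top I M _))
  have h0 (a : M) : symb I 0 a (mem_pow_zero_smul_top I M a) ∈ S := by
    have ha : a ∈ Submodule.span R (Set.range g) := hg ▸ Submodule.mem_top
    induction ha using Submodule.span_induction with
    | mem x h =>
      obtain ⟨i, rfl⟩ := h
      exact Submodule.subset_span ⟨i, rfl⟩
    | zero =>
      rw [(symb_eq_zero_iff I _).2 (zero_mem _)]
      exact zero_mem _
    | add x y _ _ h h' =>
      rw [symb_add I (mem_pow_zero_smul_top I M _) (mem_pow_zero_smul_top I M _)]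
      exact add_mem h h'
    | smul r x _ h =>
      have := S.smul_mem (symb I 0 r (mem_pow_zero_smul_top I R r)) h
      rwa [symb_smul_symb] at this
  refine Submodule.eq_top_iff'.2 fun ξ => ?_
  induction ξ using gr_induction with
  | h0 => exact zero_mem _
  | hadd ξ η hξ hη => exact add_mem hξ hη
  | h n a ha =>
    induction ha using Submodule.smul_induction_on' with
    | smul r hr m hm =>
      have := S.smul_mem (symb I n r (by simpa using hr)) (h0 m)
      rwa [symb_smul_symb] at this
    | add x hx y hy h h' =>
      rw [symb_add I hx hy]
      exact add_mem h h'

end Gr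

/-! ### Linear parts of graded modules with a differential -/

namespace DiffModule

variable {R : Type u} [CommRing R] (I : Ideal R)

/-- The linear part of a complex with `d V ⊆ I V`. -/
abbrev lin (V : DiffModule R) (hV : LinearMap.range V.d ≤ I • ⊤) : DiffModule (GrRing I) where
  carrier := GrModule I V.carrier
  d := grShift I V.d hV
  p n := grMap I (V.p n)
  d_d v := by
    induction v using gr_induction with
    | h0 => simp only [map_zero]
    | hadd ξ η hξ hη => simp only [map_add, hξ, hη, add_zero]
    | h n a ha =>
      rw [grShift_symb, grShift_symb, symb_eq_zero_iff, V.d_d]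
      exact zero_mem _
  p_p n v := by
    rw [grMap_grMap]
    congr 2
    exact LinearMap.ext (V.p_p n)
  d_p h v := by
    induction v using gr_induction with
    | h0 => simp only [map_zero]
    | hadd ξ η hξ hη => simp only [map_add, hξ, hη]
    | h n a ha => simp only [grShift_symb, grMap_symb, V.d_p h]
  p_neg h v := by
    induction v using gr_induction with
    | h0 => simp only [map_zero]
    | hadd ξ η hξ hη => simp only [map_add, hξ, hη, add_zero]
    | h n a ha =>
      rw [grMap_symb, symb_eq_zero_iff, V.p_neg h]
      exact zero_mem _

variable {I}

lemma lin_d (V : DiffModule R) (hV : LinearMap.range V.d ≤ I • ⊤) (ξ : GrModule I V.carrier) :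
    (V.lin I hV).d ξ = grShift I V.d hV ξ := rfl

lemma lin_p (V : DiffModule R) (hV : LinearMap.range V.d ≤ I • ⊤) (n : ℤ)
    (ξ : GrModule I V.carrier) : (V.lin I hV).p n ξ = grMap I (V.p n) ξ := rfl

lemma range_cone_d_le {V : DiffModule R} (hV : LinearMap.range V.d ≤ I • ⊤) (x : I) :
    LinearMap.range (V.cone (x : R)).d ≤ I • ⊤ := by
  rintro _ ⟨w, rfl⟩
  revert w
  refine forall_cone.2 fun u v => ?_
  have h : (V.cone (x : R)).d (coneMk _ u v) =
      (LinearMap.inl R V.carrier V.carrier (V.d u + (x : R) • v) : V.carrier × V.carrier) +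
        LinearMap.inr R V.carrier V.carrier (-V.d v) := by
    simp only [LinearMap.inl_apply, LinearMap.inr_apply, Prod.mk_add_mk, add_zero, zero_add]
    rfl
  rw [h]
  exact add_mem
    (map_mem_smul_top I (LinearMap.inl R V.carrier V.carrier)
      (add_mem (hV ⟨u, rfl⟩) (Submodule.smul_mem_smul x.2 trivial)))
    (map_mem_smul_top I (LinearMap.inr R V.carrier V.carrier) (neg_mem (hV ⟨v, rfl⟩)))

/-- The projection of the mapping cone to its second component. -/
def coneSnd (a : R) (L : DiffModule R) : (cone a L).carrier →ₗ[R] L.carrier := LinearMap.snd R _ _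

lemma coneMk_coneFst_coneSnd {a : R} {L : DiffModule R} (z : (cone a L).carrier) :
    coneMk a (coneFst a L z) (coneSnd a L z) = z := rfl

/-- The inclusion of the first component in the mapping cone. -/
def coneInl (a : R) (L : DiffModule R) : L.carrier →ₗ[R] (cone a L).carrier := LinearMap.inl R _ _

/-- The inclusion of the second component in the mapping cone. -/
def coneInr (a : R) (L : DiffModule R) : L.carrier →ₗ[R] (cone a L).carrier := LinearMap.inr R _ _

lemma coneInl_add_coneInr {a : R} {L : DiffModule R} (z : (cone a L).carrier) :
    coneInl a L (coneFst a L z) + coneInr a L (coneSnd a L z) = z := by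
  change coneMk a (coneFst a L z) 0 + coneMk a 0 (coneSnd a L z) = z
  simp [coneMk_coneFst_coneSnd]

/-- The linear part commutes with mapping cones. -/
lemma lin_cone_equivalent (V : DiffModule R) (hV : LinearMap.range V.d ≤ I • ⊤) (x : I) :
    ((V.cone (x : R)).lin I (range_cone_d_le hV x)).Equivalent
      ((V.lin I hV).cone (degreeOneClass I x)) := by
  have hzero {M N : Type u} [AddCommGroup M] [AddCommGroup N] [Module R M] [Module R N]
      (ξ : GrModule I M) : grMap I (0 : M →ₗ[R] N) ξ = 0 := by
    induction ξ using gr_induction with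
    | h0 => simp only [map_zero]
    | hadd ξ η hξ hη => simp only [map_add, hξ, hη, add_zero]
    | h n a ha => exact (grMap_symb ..).trans ((symb_eq_zero_iff ..).2 (zero_mem _))
  let e : GrModule I (V.cone (x : R)).carrier ≃ₗ[GrRing I]
      ((V.lin I hV).cone (degreeOneClass I x)).carrier := .ofLinearMap
    ((grMap I (coneFst (x : R) V)).prod (grMap I (coneSnd (x : R) V)))
    ((grMap I (coneInl (x : R) V)).coprod (grMap I (coneInr (x : R) V)))
    (LinearMap.ext <| forall_cone.2 fun ξ η => by
      change coneMk (degreeOneClass I x) (L := V.lin I hV)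
        (grMap I (coneFst (x : R) V)
          (grMap I (coneInl (x : R) V) ξ + grMap I (coneInr (x : R) V) η))
        (grMap I (coneSnd (x : R) V)
          (grMap I (coneInl (x : R) V) ξ + grMap I (coneInr (x : R) V) η)) = coneMk _ ξ η
      rw [coneMk_inj, map_add, map_add, grMap_grMap, grMap_grMap, grMap_grMap, grMap_grMap]
      exact ⟨(congrArg₂ _ (grMap_id I _) (hzero _)).trans (add_zero _),
        (congrArg₂ _ (hzero _) (grMap_id I _)).trans (zero_add _)⟩)
    (gr_hom_ext I fun n a ha => by
      change grMap I (coneInl (x : R) V) (grMap I (coneFst (x : R) V) (symb I n a ha)) +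
        grMap I (coneInr (x : R) V) (grMap I (coneSnd (x : R) V) (symb I n a ha)) = symb I n a ha
      simp only [grMap_symb]
      rw [← symb_add, symb_eq_symb_iff, coneInl_add_coneInr, sub_self]
      exact zero_mem _)
  have he (ξ) : e ξ = coneMk (degreeOneClass I x) (L := V.lin I hV)
    (grMap I (coneFst (x : R) V) ξ) (grMap I (coneSnd (x : R) V) ξ) := rfl
  refine ⟨e, fun ξ => ?_, fun n ξ => ?_⟩
  · rw [he, he, cone_d, coneMk_inj, lin_d, lin_d, lin_d]
    induction ξ using gr_induction with
    | h0 => simp only [map_zero, smul_zero, add_zero, neg_zero, and_self]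
    | hadd ξ η hξ hη =>
      simp only [map_add, smul_add, hξ, hη]
      exact ⟨by abel, by abel⟩
    | h n a ha =>
      rw [grShift_symb, grMap_symb, grMap_symb, grMap_symb, grMap_symb, grShift_symb, grShift_symb,
        degreeOneClass_smul_symb, ← symb_add]
      refine ⟨rfl, eq_neg_of_add_eq_zero_left ?_⟩
      rw [← symb_add, symb_eq_zero_iff]
      change -V.d (coneSnd (x : R) V a) + _ ∈ _
      rw [neg_add_cancel]
      exact zero_mem _
  · rw [he, he, cone_p, coneMk_inj, lin_p _ (range_cone_d_le hV x), lin_p _ hV, lin_p _ hV, grMap_grMap, grMap_grMap, grMap_grMap,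
      grMap_grMap]
    exact ⟨rfl, rfl⟩

lemma exists_d_eq_of_grComp {V : DiffModule R} {hV : LinearMap.range V.d ≤ I • ⊤}
    {ξ : GrModule I V.carrier} (h : ∀ j, ∃ w, (V.lin I hV).d w = grComp I j ξ) :
    ∃ w, (V.lin I hV).d w = ξ := by
  choose w hw using h
  obtain ⟨s, hs⟩ := exists_eq_sum_grComp I ξ
  refine ⟨∑ j ∈ s, w j, ?_⟩
  rw [map_sum]
  exact (Finset.sum_congr rfl fun j _ => hw j).trans hs.symm

/-- Exactness of the linear part in terms of the `I`-adic filtration. In degree `j = 0` the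
truncated subtraction does no harm because `d V ⊆ I V`. -/
lemma exists_of_exactAt_lin {V : DiffModule R} {hV : LinearMap.range V.d ≤ I • ⊤} {n : ℤ}
    (h : (V.lin I hV).ExactAt n) {j : ℕ} {z : V.carrier} (hz : z ∈ (I ^ j • ⊤ : Submodule R _))
    (hp : V.p n z = z) (hd : V.d z ∈ (I ^ (j + 2) • ⊤ : Submodule R V.carrier)) :
    ∃ w ∈ (I ^ (j - 1) • ⊤ : Submodule R V.carrier),
      z - V.d w ∈ (I ^ (j + 1) • ⊤ : Submodule R V.carrier) := by
  obtain ⟨ω, hω⟩ := h (symb I j z hz)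
    ((grMap_symb I _ hz).trans ((symb_eq_symb_iff ..).2 (by rw [hp, sub_self]; exact zero_mem _)))
    ((grShift_symb I _ hV hz).trans ((symb_eq_zero_iff ..).2 hd))
  rw [lin_d] at hω
  cases j with
  | zero =>
    refine ⟨0, zero_mem _, ?_⟩
    rw [map_zero, sub_zero, ← symb_eq_zero_iff I hz, ← grComp_symb_self I hz, ← hω,
      grComp_grShift_zero]
  | succ k =>
    obtain ⟨w, hw, hωw⟩ := exists_grComp_eq_symb I k ω
    refine ⟨w, hw, ?_⟩
    rw [← symb_eq_symb_iff I hz (map_mem_pow_succ I V.d hV hw), ← grComp_symb_self I hz, ← hω,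
      grComp_grShift_succ, hωw, grShift_symb]

/-- Graded Nakayama lemma: if the multiplication by an element of degree one is surjective on the
homology of the linear part, then this homology vanishes. -/
lemma exactAt_lin_of_exactAt_cone {V : DiffModule R} {hV : LinearMap.range V.d ≤ I • ⊤} {n : ℤ}
    {x : I} (h : ((V.lin I hV).cone (degreeOneClass I x)).ExactAt n) :
    (V.lin I hV).ExactAt n := by
  -- Induction on the internal degree `j` of the cycle: it is a boundary plus `x` times a cycle of
  -- internal degree `j - 1`.
  have key (j : ℕ) : ∀ u : GrModule I V.carrier, grComp I j u = u → grMap I (V.p n) u = u →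
      grShift I V.d hV u = 0 → ∃ w, grShift I V.d hV w = u := by
    induction j with
    | zero =>
      intro u hj hp hd
      obtain ⟨s, t, hst⟩ := exists_cone.1 (h (coneMk _ u 0)
        ((cone_p ..).trans (coneMk_inj.2 ⟨hp, map_zero _⟩))
        ((cone_d ..).trans (coneMk_eq_zero.2
          ⟨by rw [smul_zero, add_zero]; exact hd, by rw [map_zero, neg_zero]⟩)))
      rw [cone_d, coneMk_inj, lin_d] at hst
      have := congrArg (grComp I 0) hst.1
      rw [map_add, grComp_grShift_zero, grComp_degreeOneClass_smul_zero, hj, zero_add] at this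
      exact ⟨0, by rw [map_zero, ← this]⟩
    | succ k ih =>
      intro u hj hp hd
      obtain ⟨z, hz, hst⟩ := h.exists_deg rfl (z := coneMk _ u 0)
        ((cone_p ..).trans (coneMk_inj.2 ⟨hp, map_zero _⟩))
        ((cone_d ..).trans (coneMk_eq_zero.2
          ⟨by rw [smul_zero, add_zero]; exact hd, by rw [map_zero, neg_zero]⟩))
      revert z
      refine forall_cone.2 fun s t hpst hst => ?_
      rw [cone_d, coneMk_inj, lin_d, lin_d, neg_eq_zero] at hst
      rw [cone_p, coneMk_inj, lin_p, lin_p, add_sub_cancel_right] at hpst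
      obtain ⟨w, hw⟩ := ih (grComp I k t) (grComp_grComp I k t)
        (by rw [← grComp_grMap, hpst.2]) (by rw [← grComp_grShift_succ, hst.2, map_zero])
      have := congrArg (grComp I (k + 1)) hst.1
      rw [map_add, grComp_grShift_succ, grComp_degreeOneClass_smul_succ, hj, ← hw, ← map_smul,
        ← map_add] at this
      exact ⟨_, this⟩
  intro u hp hd
  rw [lin_p] at hp
  rw [lin_d] at hd
  refine exists_d_eq_of_grComp fun j => ?_
  cases j with
  | zero =>
    exact key 0 _ (grComp_grComp I 0 u) (by rw [← grComp_grMap, hp])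
      (by rw [← grComp_grShift_succ, hd, map_zero])
  | succ j =>
    exact key (j + 1) _ (grComp_grComp I _ u) (by rw [← grComp_grMap, hp])
      (by rw [← grComp_grShift_succ, hd, map_zero])

/-- If the linear part of a resolution of `M` is exact in positive degrees, then it is a resolution
of the associated graded module of `M`: exactness in degree one makes the differential strict with
respect to the `I`-adic filtrations. -/
lemma IsResolution.lin {M : Type u} [AddCommGroup M] [Module R M] {V : DiffModule R}
    {π : V.carrier →ₗ[R] M} (h : V.IsResolution π) (hV : LinearMap.range V.d ≤ I • ⊤)
    (hlin : ∀ n : ℤ, 0 < n → (V.lin I hV).ExactAt n) :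
    (V.lin I hV).IsResolution (grMap I π) where
  surjective := grMap_surjective I h.surjective
  map_p ξ := by
    rw [lin_p, grMap_grMap]
    congr 2
    exact LinearMap.ext h.map_p
  map_d ξ := by
    rw [lin_d]
    induction ξ using gr_induction with
    | h0 => simp only [map_zero]
    | hadd ξ η hξ hη => simp only [map_add, hξ, hη, add_zero]
    | h n a ha =>
      rw [grShift_symb, grMap_symb, symb_eq_zero_iff, h.map_d]
      exact zero_mem _
  exactAt := hlin
  exact_zero ξ hp hπ := by
    rw [lin_p] at hp
    -- A boundary in `I ^ (k + 1) V` is the boundary of an element of `I ^ k V`: the leading form of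
    -- a primitive in a lower power of `I` is a cycle of the linear part, hence a boundary, so that
    -- the primitive can be corrected by a boundary to lie in the next power of `I`.
    have strict (u : V.carrier) (hu : V.p 1 u = u) (k : ℕ)
        (hd : V.d u ∈ (I ^ (k + 1) • ⊤ : Submodule R V.carrier)) (i : ℕ) (hi : i ≤ k) :
        ∃ u' ∈ (I ^ i • ⊤ : Submodule R V.carrier), V.p 1 u' = u' ∧ V.d u' = V.d u := by
      induction i with
      | zero => exact ⟨u, mem_pow_zero_smul_top I _ u, hu, rfl⟩
      | succ i ih =>
        obtain ⟨u', hu', hpu', hdu'⟩ := ih (by omega)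
        obtain ⟨w, -, hw'⟩ := exists_of_exactAt_lin (hlin 1 one_pos) hu' hpu' (by
          rw [hdu']
          exact Submodule.smul_mono_left (Ideal.pow_le_pow_right (by omega)) hd)
        refine ⟨V.p 1 (u' - V.d w), map_mem_smul_top _ _ hw', V.p_p _ _, ?_⟩
        rw [V.d_p (show (1 : ℤ) = 0 + 1 by norm_num), map_sub, V.d_d, sub_zero,
          ← V.d_p (show (1 : ℤ) = 0 + 1 by norm_num), hpu', hdu']
    refine exists_d_eq_of_grComp fun j => ?_
    obtain ⟨z', hz', hξ'⟩ := exists_grComp_eq_symb I j ξ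
    obtain ⟨z, hz, hpz, hξ⟩ : ∃ (z : V.carrier) (hz : z ∈ (I ^ j • ⊤ : Submodule R V.carrier)),
        V.p 0 z = z ∧ grComp I j ξ = symb I j z hz :=
      ⟨V.p 0 z', map_mem_smul_top _ _ hz', V.p_p _ _, by
        rw [← grMap_symb I _ hz', ← hξ', ← grComp_grMap, hp]⟩
    have hπz : π z ∈ (I ^ (j + 1) • ⊤ : Submodule R M) := by
      rw [← symb_eq_zero_iff I (map_mem_smul_top _ π hz), ← grMap_symb I π hz, ← hξ, ← grComp_grMap, hπ,
        map_zero]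
    rw [hξ]
    rw [← LinearMap.range_eq_top.2 h.surjective, ← Submodule.map_top, ← Submodule.map_smul''] at hπz
    obtain ⟨b, hb, hbz⟩ := hπz
    obtain ⟨u, hu⟩ := h.exact_zero (z - V.p 0 b) (by rw [map_sub, V.p_p, hpz])
      (by rw [map_sub, h.map_p, hbz, sub_self])
    have hu1 : V.d (V.p 1 u) = z - V.p 0 b := by
      rw [V.d_p (show (1 : ℤ) = 0 + 1 by norm_num), hu, map_sub, V.p_p, hpz]
    have hb0 := map_mem_smul_top _ (V.p 0) hb
    cases j with
    | zero =>
      refine ⟨0, ?_⟩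
      rw [map_zero, eq_comm, symb_eq_zero_iff, ← sub_add_cancel z (V.p 0 b), ← hu]
      exact add_mem (by rw [zero_add, pow_one]; exact hV ⟨u, rfl⟩) hb0
    | succ k =>
      obtain ⟨u', hu', -, hdu'⟩ := strict (V.p 1 u) (V.p_p _ _) k
        (by
          rw [hu1]
          exact sub_mem hz (Submodule.smul_mono_left (Ideal.pow_le_pow_right (by omega)) hb0))
        k le_rfl
      refine ⟨symb I k u' hu', ?_⟩
      rw [lin_d, grShift_symb, symb_eq_symb_iff, hdu', hu1, sub_sub_cancel_left]
      exact neg_mem hb0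

end DiffModule

/-! ### Associated graded modules and regular elements -/

section Regular

open scoped Pointwise

variable {R : Type u} [CommRing R] {I : Ideal R} {M : Type u} [AddCommGroup M] [Module R M] {x : I}

lemma mem_pow_of_smul_mem_pow (hx : IsSMulRegular (GrModule I M) (degreeOneClass I x)) {a : M}
    {n : ℕ} (ha : (x : R) • a ∈ (I ^ (n + 1) • ⊤ : Submodule R M)) :
    a ∈ (I ^ n • ⊤ : Submodule R M) := by
  induction n with
  | zero => exact mem_pow_zero_smul_top I M a
  | succ n ih =>
    have han := ih (Submodule.smul_mono_left (Ideal.pow_le_pow_right (by omega)) ha)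
    rw [← symb_eq_zero_iff I han]
    refine hx ?_
    change degreeOneClass I x • _ = degreeOneClass I x • _
    rw [smul_zero, degreeOneClass_smul_symb, symb_eq_zero_iff]
    exact ha

lemma isSMulRegular_of_degreeOneClass (hM : (⨅ n : ℕ, I ^ n • ⊤ : Submodule R M) = ⊥)
    (hx : IsSMulRegular (GrModule I M) (degreeOneClass I x)) : IsSMulRegular M (x : R) := by
  rw [isSMulRegular_iff_right_eq_zero_of_smul]
  intro a ha
  rw [← Submodule.mem_bot R, ← hM, Submodule.mem_iInf]
  intro n
  refine mem_pow_of_smul_mem_pow hx ?_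
  rw [ha]
  exact zero_mem _

/-- If the class of `x` of degree one is regular on the associated graded module of `M`, then the
associated graded module of `M / x M` is the quotient by this class. -/
lemma nonempty_quotSMulTop_equiv (hx : IsSMulRegular (GrModule I M) (degreeOneClass I x)) :
    Nonempty (QuotSMulTop (degreeOneClass I x) (GrModule I M) ≃ₗ[GrRing I]
      GrModule I (QuotSMulTop (x : R) M)) := by
  let q : M →ₗ[R] QuotSMulTop (x : R) M := Submodule.mkQ ((x : R) • (⊤ : Submodule R M))
  have hq : Function.Surjective q := Submodule.mkQ_surjective _
  have hker (a : M) : q a = 0 ↔ ∃ t, (x : R) • t = a := by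
    rw [Submodule.mkQ_apply, Submodule.Quotient.mk_eq_zero,
      Submodule.mem_smul_pointwise_iff_exists]
    simp
  refine ⟨(Submodule.quotEquivOfEq _ _ ?_).trans
    ((grMap I q).quotKerEquivOfSurjective (grMap_surjective I hq))⟩
  refine le_antisymm ?_ fun ξ hξ => ?_
  · intro ξ hξ
    obtain ⟨ξ, -, rfl⟩ := (Submodule.mem_smul_pointwise_iff_exists _ _ _).1 hξ
    rw [LinearMap.mem_ker]
    induction ξ using gr_induction with
    | h0 => simp only [smul_zero, map_zero]
    | hadd ξ η h h' =>
      rw [smul_add, map_add, h (Submodule.smul_mem_pointwise_smul _ _ _ trivial),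
        h' (Submodule.smul_mem_pointwise_smul _ _ _ trivial), add_zero]
    | h n a ha =>
      rw [degreeOneClass_smul_symb, grMap_symb, symb_eq_zero_iff, (hker _).2 ⟨a, rfl⟩]
      exact zero_mem _
  · rw [LinearMap.mem_ker] at hξ
    obtain ⟨s, hs⟩ := exists_eq_sum_grComp I ξ
    rw [hs]
    refine sum_mem fun j _ => ?_
    obtain ⟨a, ha, haj⟩ := exists_grComp_eq_symb I j ξ
    rw [haj]
    have hqa : q a ∈ (I ^ (j + 1) • ⊤ : Submodule R (QuotSMulTop (x : R) M)) := by
      rw [← symb_eq_zero_iff I (map_mem_smul_top _ q ha), ← grMap_symb I q ha, ← haj, ← grComp_grMap, hξ,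
        map_zero]
    rw [← LinearMap.range_eq_top.2 hq, ← Submodule.map_top, ← Submodule.map_smul''] at hqa
    obtain ⟨b, hb, hba⟩ := hqa
    obtain ⟨t, ht⟩ := (hker (a - b)).1 (by rw [map_sub, hba, sub_self])
    cases j with
    | zero =>
      have h0 : symb I 0 a ha = 0 := by
        rw [symb_eq_zero_iff, ← sub_add_cancel a b, ← ht]
        exact add_mem (mem_pow_succ_of_smul I x (mem_pow_zero_smul_top I M t)) hb
      rw [h0]
      exact zero_mem _
    | succ k =>
      have htk : t ∈ (I ^ k • ⊤ : Submodule R M) := by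
        refine mem_pow_of_smul_mem_pow hx ?_
        rw [ht]
        exact sub_mem ha (Submodule.smul_mono_left (Ideal.pow_le_pow_right (by omega)) hb)
      have : symb I (k + 1) a ha = degreeOneClass I x • symb I k t htk := by
        rw [degreeOneClass_smul_symb, symb_eq_symb_iff, ht, sub_sub_cancel]
        exact hb
      rw [this]
      exact Submodule.smul_mem_pointwise_smul _ _ _ trivial

end Regular

/-! ### Chain complexes of modules -/

namespace DiffModule

variable {A : Type u} [CommRing A]

lemma exactAt_iff_forall (K : ChainComplex (ModuleCat.{u} A) ℕ) (n : ℕ) :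
    K.ExactAt n ↔ ∀ a : K.X n, (K.d n (n - 1)).hom a = 0 → ∃ b, (K.d (n + 1) n).hom b = a := by
  rw [K.exactAt_iff' (n + 1) n (n - 1) (by simp) (by cases n <;> simp),
    ShortComplex.moduleCat_exact_iff]
  rfl

/-- The comparison of exactness for a chain complex `K` and a graded module with a differential `L`
whose parts of degree `n` are identified with `K.X n`. -/
lemma exactAt_iff_of_retract (K : ChainComplex (ModuleCat.{u} A) ℕ) (L : DiffModule A)
    (ι : ∀ n, K.X n →ₗ[A] L.carrier) (ρ : ∀ n, L.carrier →ₗ[A] K.X n)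
    (h1 : ∀ n a, ρ n (ι n a) = a) (h2 : ∀ (n : ℕ) v, ι n (ρ n v) = L.p n v)
    (h3 : ∀ n a, L.d (ι (n + 1) a) = ι n ((K.d (n + 1) n).hom a)) (n : ℕ) :
    K.ExactAt n ↔ L.ExactAt n := by
  have hp (n : ℕ) (a) : L.p n (ι n a) = ι n a := by rw [← h2, h1]
  have h4 (n : ℕ) (v) : ρ n (L.d v) = (K.d (n + 1) n).hom (ρ (n + 1) v) := by
    rw [← h1 n ((K.d (n + 1) n).hom _), ← h3, h2, L.d_p (show ((n + 1 : ℕ) : ℤ) = n + 1 by simp),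
      ← h2, h1]
  rw [exactAt_iff_forall]
  refine ⟨fun H z hz hdz => ?_, fun H a ha => ?_⟩
  · obtain ⟨b, hb⟩ := H (ρ n z) (by
      cases n with
      | zero => rw [K.shape _ _ (by simp)]; rfl
      | succ n => exact (h4 n z).symm.trans (by rw [hdz, map_zero]))
    exact ⟨ι (n + 1) b, by rw [h3, hb, h2, hz]⟩
  · obtain ⟨w, hw⟩ := H (ι n a) (hp n a) (by
      cases n with
      | zero => exact L.d_of_deg_zero (hp 0 a)
      | succ n => rw [h3]; exact (congrArg (ι n) ha).trans (map_zero _))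
    exact ⟨ρ (n + 1) w, by rw [← h4, hw, h1]⟩

lemma d_mem_range_p (L : DiffModule A) (n : ℕ) {v : L.carrier}
    (hv : v ∈ LinearMap.range (L.p (n + 1 : ℕ))) : L.d v ∈ LinearMap.range (L.p n) := by
  obtain ⟨w, rfl⟩ := hv
  exact ⟨L.d w, (L.d_p (by simp) w).symm⟩

/-- The chain complex formed by the parts of degree `n`. -/
def toComplex (L : DiffModule A) : ChainComplex (ModuleCat.{u} A) ℕ :=
  ChainComplex.of (fun n => ModuleCat.of A (LinearMap.range (L.p n)))
    (fun n => ModuleCat.ofHom (L.d.restrict fun _ hv => L.d_mem_range_p n hv))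
    (fun n => by
      ext v
      exact L.d_d v)

lemma toComplex_d (L : DiffModule A) (n : ℕ) : L.toComplex.d (n + 1) n =
    ModuleCat.ofHom (L.d.restrict fun _ hv => L.d_mem_range_p n hv) :=
  ChainComplex.of_d (fun n : ℕ => ModuleCat.of A (LinearMap.range (L.p n)))
    (fun n => ModuleCat.ofHom (L.d.restrict fun _ hv => L.d_mem_range_p n hv)) n

/-- The inclusion of the part of degree `n`. -/
def toComplexι (L : DiffModule A) (n : ℕ) : L.toComplex.X n →ₗ[A] L.carrier :=
  (LinearMap.range (L.p n)).subtype

/-- The projection to the part of degree `n`. -/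
def toComplexρ (L : DiffModule A) (n : ℕ) : L.carrier →ₗ[A] L.toComplex.X n :=
  (L.p n).rangeRestrict

lemma toComplexρ_ι (L : DiffModule A) (n : ℕ) (a : L.toComplex.X n) :
    L.toComplexρ n (L.toComplexι n a) = a := by
  obtain ⟨_, v, rfl⟩ := a
  exact Subtype.ext (L.p_p _ _)

lemma toComplexι_ρ (L : DiffModule A) (n : ℕ) (v : L.carrier) :
    L.toComplexι n (L.toComplexρ n v) = L.p n v := rfl

lemma d_toComplexι (L : DiffModule A) (n : ℕ) (a : L.toComplex.X (n + 1)) :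
    L.d (L.toComplexι (n + 1) a) = L.toComplexι n ((L.toComplex.d (n + 1) n).hom a) :=
  (congrArg (fun f => L.toComplexι n (f.hom a)) (L.toComplex_d n)).symm

lemma exactAt_toComplex_iff (L : DiffModule A) (n : ℕ) : L.toComplex.ExactAt n ↔ L.ExactAt n :=
  exactAt_iff_of_retract _ _ L.toComplexι L.toComplexρ L.toComplexρ_ι L.toComplexι_ρ
    L.d_toComplexι n

lemma linearPart_d {I : Ideal A} {F : ChainComplex (ModuleCat.{u} A) ℕ} (hF : IsMinimalFree I F)
    (n : ℕ) : (linearPart I F hF).d (n + 1) n =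
      ModuleCat.ofHom (grShift I (F.d (n + 1) n).hom (hF.range_d_le n)) :=
  ChainComplex.of_d (fun n => ModuleCat.of (GrRing I) (GrModule I (F.X n)))
    (fun n => ModuleCat.ofHom (grShift I (F.d (n + 1) n).hom (hF.range_d_le n))) n

/-- Complexes of finitely generated free modules with `d V ⊆ I V`. -/
structure IsMinimal (I : Ideal A) (V : DiffModule A) : Prop where
  free (n : ℤ) : Module.Free A (LinearMap.range (V.p n))
  finite (n : ℤ) : Module.Finite A (LinearMap.range (V.p n))
  range_d_le : LinearMap.range V.d ≤ I • ⊤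

namespace IsMinimal

variable {I : Ideal A} {V : DiffModule A}

lemma isMinimalFree (hV : V.IsMinimal I) : IsMinimalFree I V.toComplex where
  free n := hV.free n
  finite n := hV.finite n
  range_d_le n := by
    rintro _ ⟨a, rfl⟩
    rw [← V.toComplexρ_ι n (((V.toComplex.d (n + 1) n).hom a)), ← V.d_toComplexι]
    exact map_mem_smul_top I (V.toComplexρ n) (hV.range_d_le ⟨_, rfl⟩)

lemma cone (hV : V.IsMinimal I) (x : I) : (V.cone (x : A)).IsMinimal I := by
  have e (n : ℤ) : (LinearMap.range (V.p n) × LinearMap.range (V.p (n - 1))) ≃ₗ[A]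
      LinearMap.range ((V.cone (x : A)).p n) :=
    .ofBijective
      ((LinearMap.prodMap (Submodule.subtype _) (Submodule.subtype _)).codRestrict
        (LinearMap.range ((V.cone (x : A)).p n)) (by
          rintro ⟨⟨_, u, rfl⟩, ⟨_, v, rfl⟩⟩
          exact ⟨coneMk _ u v, rfl⟩))
      ⟨fun a b h => Prod.ext (Subtype.ext (congrArg (fun w => w.1.1) h))
        (Subtype.ext (congrArg (fun w => w.1.2) h)), by
          rintro ⟨_, z, rfl⟩
          exact ⟨(⟨_, z.1, rfl⟩, ⟨_, z.2, rfl⟩), rfl⟩⟩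
  have := hV.free
  have := hV.finite
  exact ⟨fun n => .of_equiv (e n), fun n => .equiv (e n), range_cone_d_le hV.range_d_le x⟩

lemma exactAt_linearPart_iff (hV : V.IsMinimal I) (n : ℕ) :
    (linearPart I V.toComplex hV.isMinimalFree).ExactAt n ↔
      (V.lin I hV.range_d_le).ExactAt n := by
  refine exactAt_iff_of_retract _ _
    (fun n => (grMap I (V.toComplexι n) : GrModule I (V.toComplex.X n) →ₗ[GrRing I] _))
    (fun n => (grMap I (V.toComplexρ n) : _ →ₗ[GrRing I] GrModule I (V.toComplex.X n)))
    (fun n (a : GrModule I (V.toComplex.X n)) => ?_) (fun n v => ?_)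
    (fun n (a : GrModule I (V.toComplex.X (n + 1))) => ?_) n
  · refine (grMap_grMap I _ _ a).trans ?_
    rw [show V.toComplexρ n ∘ₗ V.toComplexι n = .id from LinearMap.ext (V.toComplexρ_ι n)]
    exact grMap_id I a
  · exact grMap_grMap I _ _ v
  · rw [linearPart_d]
    change grShift I V.d hV.range_d_le (grMap I (V.toComplexι (n + 1)) a) =
      grMap I (V.toComplexι n) (grShift I _ (hV.isMinimalFree.range_d_le n) a)
    induction a using gr_induction with
    | h0 => simp only [map_zero]
    | hadd ξ η hξ hη => simp only [map_add, hξ, hη]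
    | h m a ha => simp only [grMap_symb, grShift_symb, V.d_toComplexι]

end IsMinimal

/-- The projective resolution given by a resolution of `N` by projective modules. -/
def IsResolution.projectiveResolution {N : Type u} [AddCommGroup N] [Module A N] {L : DiffModule A}
    {π : L.carrier →ₗ[A] N} (h : L.IsResolution π)
    (hL : ∀ n : ℕ, Projective (L.toComplex.X n)) : ProjectiveResolution (ModuleCat.of A N) where
  complex := L.toComplex
  projective := hL
  π := (ChainComplex.toSingle₀Equiv _ _).symm ⟨ModuleCat.ofHom (π ∘ₗ L.toComplexι 0), by
    ext a
    change π (L.toComplexι 0 ((L.toComplex.d 1 0).hom a)) = 0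
    rw [← L.d_toComplexι, h.map_d]⟩
  quasiIso := ⟨fun n => by
    cases n
    · rw [ChainComplex.quasiIsoAt₀_iff, ShortComplex.quasiIso_iff_of_zeros']
      · have hf := ChainComplex.toSingle₀Equiv_symm_apply_f_zero (C := L.toComplex)
          (ModuleCat.ofHom (π ∘ₗ L.toComplexι 0)) (by
            ext a
            change π (L.toComplexι 0 ((L.toComplex.d 1 0).hom a)) = 0
            rw [← L.d_toComplexι, h.map_d])
        refine ⟨?_, ?_⟩
        · rw [ShortComplex.moduleCat_exact_iff]
          intro (a : L.toComplex.X 0) ha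
          have ha' : π (L.toComplexι 0 a) = 0 := (congrArg (fun f => f.hom a) hf).symm.trans ha
          have hpa : L.p 0 (L.toComplexι 0 a) = L.toComplexι 0 a :=
            congrArg (L.toComplexι 0) (L.toComplexρ_ι 0 a)
          obtain ⟨w, hw⟩ := h.exact_zero _ hpa ha'
          refine ⟨L.toComplexρ 1 w, Subtype.ext ?_⟩
          change L.toComplexι 0 ((L.toComplex.d 1 0).hom (L.toComplexρ 1 w)) = L.toComplexι 0 a
          rw [← L.d_toComplexι, L.toComplexι_ρ, L.d_p (show ((0 + 1 : ℕ) : ℤ) = 0 + 1 by norm_num),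
            hw, hpa]
        · change Epi (((ChainComplex.toSingle₀Equiv _ _).symm ⟨_, _⟩ :
            L.toComplex ⟶ (ChainComplex.single₀ _).obj _).f 0)
          rw [hf]
          refine (ModuleCat.epi_iff_surjective _).2 fun n => ?_
          obtain ⟨v, rfl⟩ := h.surjective n
          exact ⟨L.toComplexρ 0 v, h.map_p v⟩
      all_goals rfl
    · rw [quasiIsoAt_iff_exactAt']
      · exact (L.exactAt_toComplex_iff _).2 (h.exactAt _ (by positivity))
      · apply ChainComplex.exactAt_succ_single_obj⟩

end DiffModule

/-! ### Uniqueness of minimal resolutions and the linearity defect -/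

section Uniqueness

variable {R : Type u} [CommRing R] {I : Ideal R}

lemma grMap_linearPart_d {P Q : ChainComplex (ModuleCat.{u} R) ℕ} (hP : IsMinimalFree I P)
    (hQ : IsMinimalFree I Q) (f : P ⟶ Q) (n : ℕ) (a : GrModule I (P.X (n + 1))) :
    grMap I (f.f n).hom (((linearPart I P hP).d (n + 1) n).hom a) =
      ((linearPart I Q hQ).d (n + 1) n).hom (grMap I (f.f (n + 1)).hom a) := by
  rw [DiffModule.linearPart_d, DiffModule.linearPart_d]
  change grMap I (f.f n).hom (grShift I _ (hP.range_d_le n) a) =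
    grShift I _ (hQ.range_d_le n) (grMap I (f.f (n + 1)).hom a)
  induction a using gr_induction with
  | h0 => simp only [map_zero]
  | hadd ξ η hξ hη => simp only [map_add, hξ, hη]
  | h m a ha =>
    have h : (f.f n).hom ((P.d (n + 1) n).hom a) = (Q.d (n + 1) n).hom ((f.f (n + 1)).hom a) :=
      (congrArg (fun g => g.hom a) (f.comm (n + 1) n)).symm
    simp only [grMap_symb, grShift_symb, h]

/-- A homotopy between maps of minimal complexes vanishes on associated graded modules, so that
homotopy equivalent minimal complexes have isomorphic linear parts. -/
lemma exactAt_linearPart_of_homotopyEquiv {P Q : ChainComplex (ModuleCat.{u} R) ℕ}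
    (hP : IsMinimalFree I P) (hQ : IsMinimalFree I Q) (e : HomotopyEquiv P Q) {n : ℕ}
    (h : (linearPart I P hP).ExactAt n) : (linearPart I Q hQ).ExactAt n := by
  rw [DiffModule.exactAt_iff_forall] at h ⊢
  intro (a : GrModule I (Q.X n)) ha
  obtain ⟨b, hb⟩ := h (grMap I (e.inv.f n).hom a) (by
    cases n with
    | zero => rw [HomologicalComplex.shape _ _ _ (by simp)]; rfl
    | succ n =>
      refine (grMap_linearPart_d hQ hP e.inv n a).symm.trans ?_
      refine (congrArg (grMap I (e.inv.f n).hom) ha).trans (map_zero _))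
  have hid : grMap I (e.hom.f n).hom (grMap I (e.inv.f n).hom a) = a := by
    refine (grMap_grMap I _ _ a).trans (grMap_eq_self I (fun v => ?_) a)
    have hc := e.homotopyInvHomId.comm n
    rw [dNext_nat, Homotopy.prevD_chainComplex] at hc
    have hv := congrArg (fun g => g.hom v) hc
    change (e.hom.f n).hom ((e.inv.f n).hom v) =
      ((e.homotopyInvHomId.hom (n - 1) n).hom ((Q.d n (n - 1)).hom v) +
        (Q.d (n + 1) n).hom ((e.homotopyInvHomId.hom n (n + 1)).hom v)) + v at hv
    change (e.hom.f n).hom ((e.inv.f n).hom v) - v ∈ _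
    rw [hv, add_sub_cancel_right]
    refine add_mem (map_mem_smul_top I (e.homotopyInvHomId.hom (n - 1) n).hom ?_)
      (hQ.range_d_le n ⟨_, rfl⟩)
    cases n with
    | zero => rw [Q.shape _ _ (by simp)]; exact zero_mem _
    | succ n => exact hQ.range_d_le n ⟨_, rfl⟩
  exact ⟨grMap I (e.hom.f (n + 1)).hom b, (grMap_linearPart_d hP hQ e.hom n b).symm.trans
    ((congrArg (grMap I (e.hom.f n).hom) hb).trans hid)⟩

end Uniqueness

section Local

variable {R : Type u} [CommRing R] [IsLocalRing R] {N : Type u} [AddCommGroup N] [Module R N]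

open IsLocalRing in
/-- The linearity defect can be computed with any minimal resolution. -/
theorem DiffModule.IsResolution.linearityDefect_eq {V : DiffModule R} {π : V.carrier →ₗ[R] N}
    (h : V.IsResolution π) (hV : V.IsMinimal (maximalIdeal R)) :
    linearityDefect R N =
      ⨆ (n : ℕ) (_ : ¬ (V.lin (maximalIdeal R) hV.range_d_le).ExactAt n), (n : EReal) := by
  have hproj (n : ℕ) : Projective (V.toComplex.X n) := by
    have := hV.free n
    exact (IsProjective.iff_projective (LinearMap.range (V.p n))).1 inferInstance
  let Q := h.projectiveResolution hproj
  have hQ : IsMinimalFree (maximalIdeal R) Q.complex := hV.isMinimalFree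
  have key (P : ProjectiveResolution (ModuleCat.of R N))
      (hP : IsMinimalFree (maximalIdeal R) P.complex) (n : ℕ) :
      Limits.IsZero ((linearPart (maximalIdeal R) P.complex hP).homology n) ↔
        (V.lin (maximalIdeal R) hV.range_d_le).ExactAt n := by
    rw [← HomologicalComplex.exactAt_iff_isZero_homology, ← hV.exactAt_linearPart_iff]
    exact ⟨exactAt_linearPart_of_homotopyEquiv hP hQ (ProjectiveResolution.homotopyEquiv P Q),
      exactAt_linearPart_of_homotopyEquiv hQ hP (ProjectiveResolution.homotopyEquiv Q P)⟩
  refine le_antisymm (iSup_le fun P => iSup_le fun hP => iSup_le fun n => iSup_le fun hn => ?_)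
    (iSup_le fun n => iSup_le fun hn => ?_)
  · rw [key] at hn
    exact le_iSup_of_le n (le_iSup_of_le hn le_rfl)
  · rw [← key Q hQ] at hn
    exact le_iSup_of_le Q (le_iSup_of_le hQ (le_iSup_of_le n (le_iSup_of_le hn le_rfl)))

open IsLocalRing in
/-- A module is Koszul if and only if the linear part of its minimal resolution has homology exactly
in degree zero. -/
lemma DiffModule.IsResolution.isKoszul_iff {V : DiffModule R} {π : V.carrier →ₗ[R] N}
    (h : V.IsResolution π) (hV : V.IsMinimal (maximalIdeal R)) :
    IsKoszul R N ↔ (∀ n : ℤ, 0 < n → (V.lin (maximalIdeal R) hV.range_d_le).ExactAt n) ∧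
      ¬ (V.lin (maximalIdeal R) hV.range_d_le).ExactAt 0 := by
  rw [IsKoszul, h.linearityDefect_eq hV]
  set L := V.lin (maximalIdeal R) hV.range_d_le
  refine ⟨fun H => ?_, fun H => ?_⟩
  · have hpos (n : ℤ) (hn : 0 < n) : L.ExactAt n := by
      by_contra hL
      lift n to ℕ using hn.le
      have : (n : EReal) ≤ 0 := H ▸ le_iSup_of_le n (le_iSup_of_le hL le_rfl)
      have : n ≤ 0 := by exact_mod_cast this
      omega
    refine ⟨hpos, fun h0 => ?_⟩
    have hbot : (⨆ (n : ℕ) (_ : ¬ L.ExactAt n), (n : EReal)) = ⊥ := by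
      refine le_bot_iff.1 (iSup_le fun n => iSup_le fun hn => (hn ?_).elim)
      rcases Nat.eq_zero_or_pos n with rfl | hn
      · exact h0
      · exact hpos _ (by exact_mod_cast hn)
    rw [hbot] at H
    exact EReal.bot_ne_zero H
  · refine le_antisymm (iSup_le fun n => iSup_le fun hn => ?_)
      (le_iSup_of_le 0 (le_iSup_of_le H.2 (by simp)))
    rcases Nat.eq_zero_or_pos n with rfl | hn'
    · simp
    · exact (hn (H.1 _ (by exact_mod_cast hn'))).elim

end Local

/-! ### Existence of minimal resolutions -/

namespace DiffModule

section OfSequence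

variable {A : Type u} [CommRing A] (F : ℕ → Type u) [∀ n, AddCommGroup (F n)]
  [∀ n, Module A (F n)] (δ : ∀ n, F (n + 1) →ₗ[A] F n)

/-- The components of the differential of `ofSequence`. -/
def ofSequenceD : ∀ n, F n →ₗ[A] ⨁ n, F n
  | 0 => 0
  | n + 1 => DirectSum.lof A ℕ F n ∘ₗ δ n

/-- The complex formed by a sequence of modules and maps. -/
def ofSequence (hδ : ∀ n a, δ n (δ (n + 1) a) = 0) : DiffModule A where
  carrier := ⨁ n, F n
  d := DirectSum.toModule A ℕ _ (ofSequenceD F δ)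
  p k := DirectSum.toModule A ℕ _ fun n => if (n : ℤ) = k then DirectSum.lof A ℕ F n else 0
  d_d v := by
    induction v using DirectSum.induction_on with
    | zero => simp only [map_zero]
    | add v w hv hw => simp only [map_add, hv, hw, add_zero]
    | of n a =>
      rw [← DirectSum.lof_eq_of A, DirectSum.toModule_lof]
      match n, a with
      | 0, a => exact map_zero _
      | 1, a =>
        change DirectSum.toModule A ℕ _ (ofSequenceD F δ) (DirectSum.lof A ℕ F 0 (δ 0 a)) = 0
        rw [DirectSum.toModule_lof]
        rfl
      | n + 2, a =>
        change DirectSum.toModule A ℕ _ (ofSequenceD F δ)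
          (DirectSum.lof A ℕ F (n + 1) (δ (n + 1) a)) = 0
        rw [DirectSum.toModule_lof]
        exact (congrArg (DirectSum.lof A ℕ F n) (hδ n a)).trans (map_zero _)
  p_p k v := by
    induction v using DirectSum.induction_on with
    | zero => simp only [map_zero]
    | add v w hv hw => simp only [map_add, hv, hw]
    | of n a =>
      rw [← DirectSum.lof_eq_of A, DirectSum.toModule_lof]
      split_ifs with h
      · rw [DirectSum.toModule_lof, if_pos h]
      · rw [LinearMap.zero_apply, map_zero]
  d_p {k l} hkl v := by
    induction v using DirectSum.induction_on with
    | zero => simp only [map_zero]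
    | add v w hv hw => simp only [map_add, hv, hw]
    | of n a =>
      rw [← DirectSum.lof_eq_of A, DirectSum.toModule_lof, DirectSum.toModule_lof]
      match n, a with
      | 0, a =>
        change DirectSum.toModule A ℕ _ (ofSequenceD F δ) _ = DirectSum.toModule A ℕ _ _ 0
        rw [map_zero]
        split_ifs with h
        · rw [DirectSum.toModule_lof]
          rfl
        · rw [LinearMap.zero_apply, map_zero]
      | n + 1, a =>
        change DirectSum.toModule A ℕ _ (ofSequenceD F δ) _ =
          DirectSum.toModule A ℕ _ _ (DirectSum.lof A ℕ F n (δ n a))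
        rw [DirectSum.toModule_lof]
        by_cases h : (n : ℤ) = l
        · rw [if_pos h, if_pos (by push_cast; omega), DirectSum.toModule_lof]
          rfl
        · rw [if_neg h, if_neg (by push_cast; omega), LinearMap.zero_apply, LinearMap.zero_apply,
            map_zero]
  p_neg {k} hk v := by
    induction v using DirectSum.induction_on with
    | zero => simp only [map_zero]
    | add v w hv hw => simp only [map_add, hv, hw, add_zero]
    | of n a =>
      rw [← DirectSum.lof_eq_of A, DirectSum.toModule_lof, if_neg (by omega), LinearMap.zero_apply]

variable {F δ} (hδ : ∀ n a, δ n (δ (n + 1) a) = 0)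

/-- The inclusion of the part of degree `n`. -/
def ofSequenceι (n : ℕ) : F n →ₗ[A] (ofSequence F δ hδ).carrier := DirectSum.lof A ℕ F n

lemma ofSequenceι_injective (n : ℕ) : Function.Injective (ofSequenceι hδ n) :=
  DirectSum.of_injective n

lemma ofSequence_p_self (n : ℕ) (a : F n) :
    (ofSequence F δ hδ).p n (ofSequenceι hδ n a) = ofSequenceι hδ n a := by
  change DirectSum.toModule A ℕ (⨁ n, F n) _ (DirectSum.lof A ℕ F n a) = _
  rw [DirectSum.toModule_lof, if_pos rfl]
  rfl

lemma ofSequence_p_of_ne {n : ℕ} {k : ℤ} (h : (n : ℤ) ≠ k) (a : F n) :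
    (ofSequence F δ hδ).p k (ofSequenceι hδ n a) = 0 := by
  change DirectSum.toModule A ℕ (⨁ n, F n) _ (DirectSum.lof A ℕ F n a) = _
  rw [DirectSum.toModule_lof, if_neg h]
  rfl

lemma ofSequence_d_succ (n : ℕ) (a : F (n + 1)) :
    (ofSequence F δ hδ).d (ofSequenceι hδ (n + 1) a) = ofSequenceι hδ n (δ n a) := by
  change DirectSum.toModule A ℕ (⨁ n, F n) _ (DirectSum.lof A ℕ F (n + 1) a) = _
  rw [DirectSum.toModule_lof]
  rfl

lemma ofSequence_d_zero (a : F 0) : (ofSequence F δ hδ).d (ofSequenceι hδ 0 a) = 0 := by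
  change DirectSum.toModule A ℕ (⨁ n, F n) _ (DirectSum.lof A ℕ F 0 a) = _
  rw [DirectSum.toModule_lof]
  rfl

lemma ofSequence_induction {P : (ofSequence F δ hδ).carrier → Prop} (v)
    (h0 : P 0) (hadd : ∀ v w, P v → P w → P (v + w)) (h : ∀ n a, P (ofSequenceι hδ n a)) : P v := by
  change ⨁ n, F n at v
  induction v using DirectSum.induction_on with
  | zero => exact h0
  | add v w hv hw => exact hadd v w hv hw
  | of n a => exact h n a

lemma exists_ofSequenceι_eq_p (n : ℕ) (v) :
    ∃ a, ofSequenceι hδ n a = (ofSequence F δ hδ).p n v := by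
  induction v using ofSequence_induction with
  | h0 => exact ⟨0, by simp only [map_zero]⟩
  | hadd v w hv hw =>
    obtain ⟨a, ha⟩ := hv
    obtain ⟨b, hb⟩ := hw
    exact ⟨a + b, by rw [map_add, map_add, ha, hb]⟩
  | h m a =>
    by_cases hm : m = n
    · subst hm
      exact ⟨a, (ofSequence_p_self hδ m a).symm⟩
    · exact ⟨0, by rw [map_zero, ofSequence_p_of_ne hδ (by exact_mod_cast hm)]⟩

lemma range_ofSequence_p (n : ℕ) :
    LinearMap.range ((ofSequence F δ hδ).p n) = LinearMap.range (ofSequenceι hδ n) := by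
  refine le_antisymm ?_ ?_
  · rintro _ ⟨v, rfl⟩
    exact exists_ofSequenceι_eq_p hδ n v
  · rintro _ ⟨a, rfl⟩
    exact ⟨_, ofSequence_p_self hδ n a⟩

lemma ofSequence_isMinimal {I : Ideal A} [∀ n, Module.Free A (F n)] [∀ n, Module.Finite A (F n)]
    (hI : ∀ n a, δ n a ∈ (I • ⊤ : Submodule A (F n))) : (ofSequence F δ hδ).IsMinimal I where
  free k := by
    rcases lt_or_ge k 0 with hk | hk
    · have : (ofSequence F δ hδ).p k = 0 := LinearMap.ext fun v => DiffModule.p_neg _ hk v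
      rw [this, LinearMap.range_zero]
      infer_instance
    · lift k to ℕ using hk
      rw [range_ofSequence_p]
      exact .of_equiv (LinearEquiv.ofInjective _ (ofSequenceι_injective hδ k))
  finite k := by
    rcases lt_or_ge k 0 with hk | hk
    · have : (ofSequence F δ hδ).p k = 0 := LinearMap.ext fun v => DiffModule.p_neg _ hk v
      rw [this, LinearMap.range_zero]
      infer_instance
    · lift k to ℕ using hk
      rw [range_ofSequence_p]
      infer_instance
  range_d_le := by
    rintro _ ⟨v, rfl⟩
    induction v using ofSequence_induction with
    | h0 => rw [map_zero]; exact zero_mem _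
    | hadd v w hv hw => rw [map_add]; exact add_mem hv hw
    | h n a =>
      cases n with
      | zero => rw [ofSequence_d_zero]; exact zero_mem _
      | succ n =>
        rw [ofSequence_d_succ]
        exact map_mem_smul_top I _ (hI n a)

lemma exists_isResolution_ofSequence {N : Type u} [AddCommGroup N] [Module A N] (ε : F 0 →ₗ[A] N)
    (hε : Function.Surjective ε) (hεδ : ∀ a, ε (δ 0 a) = 0) (h0 : ∀ a, ε a = 0 → ∃ b, δ 0 b = a)
    (h : ∀ n a, δ n a = 0 → ∃ b, δ (n + 1) b = a) :
    ∃ π, (ofSequence F δ hδ).IsResolution (N := N) π := by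
  let c : ∀ n, F n →ₗ[A] N := fun n => match n with
    | 0 => ε
    | _ + 1 => 0
  let π : (ofSequence F δ hδ).carrier →ₗ[A] N := DirectSum.toModule A ℕ N c
  have hπ (n : ℕ) (a : F n) : π (ofSequenceι hδ n a) = c n a := DirectSum.toModule_lof ..
  have hexact (k : ℤ) (hk : 0 < k) : (ofSequence F δ hδ).ExactAt k := by
    obtain ⟨n, rfl⟩ : ∃ n : ℕ, k = (n + 1 : ℕ) := ⟨(k - 1).toNat, by omega⟩
    intro z hz hdz
    obtain ⟨a, ha⟩ := exists_ofSequenceι_eq_p hδ (n + 1) z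
    rw [hz] at ha
    subst ha
    rw [ofSequence_d_succ, ← map_zero (ofSequenceι hδ n),
      (ofSequenceι_injective hδ n).eq_iff] at hdz
    obtain ⟨b, rfl⟩ := h n a hdz
    exact ⟨_, ofSequence_d_succ hδ (n + 1) b⟩
  refine ⟨π, fun x => ?_, fun v => ?_, fun v => ?_, fun z hz hπz => ?_, hexact⟩
  · obtain ⟨a, rfl⟩ := hε x
    exact ⟨_, hπ 0 a⟩
  · induction v using ofSequence_induction with
    | h0 => simp only [map_zero]
    | hadd v w hv hw => simp only [map_add, hv, hw]
    | h n a =>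
      cases n with
      | zero => exact congrArg π (ofSequence_p_self hδ 0 a)
      | succ n =>
        rw [ofSequence_p_of_ne hδ (by omega), map_zero, hπ]
        rfl
  · induction v using ofSequence_induction with
    | h0 => simp only [map_zero]
    | hadd v w hv hw => simp only [map_add, hv, hw, add_zero]
    | h n a =>
      match n, a with
      | 0, a => rw [ofSequence_d_zero, map_zero]
      | 1, a =>
        rw [ofSequence_d_succ, hπ]
        exact hεδ a
      | n + 2, a =>
        rw [ofSequence_d_succ, hπ]
        rfl
  · obtain ⟨a, ha⟩ := exists_ofSequenceι_eq_p hδ 0 z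
    rw [Nat.cast_zero, hz] at ha
    subst ha
    rw [hπ] at hπz
    obtain ⟨b, rfl⟩ := h0 a hπz
    exact ⟨_, ofSequence_d_succ hδ 0 b⟩

end OfSequence

end DiffModule

section Existence

variable (R : Type u) [CommRing R] [IsLocalRing R]

open IsLocalRing TensorProduct in
/-- The projective cover of a finitely generated module over a local ring. -/
lemma exists_minimal_cover (N : Type u) [AddCommGroup N] [Module R N] [Module.Finite R N] :
    ∃ (n : ℕ) (f : (Fin n → R) →ₗ[R] N), Function.Surjective f ∧
      LinearMap.ker f ≤ maximalIdeal R • (⊤ : Submodule R (Fin n → R)) := by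
  let b := Module.finBasis (ResidueField R) (ResidueField R ⊗[R] N)
  have hmk : Function.Surjective (TensorProduct.mk R (ResidueField R) N 1) :=
    TensorProduct.mk_surjective R N (ResidueField R) Ideal.Quotient.mk_surjective
  choose g hg using fun i => hmk (b i)
  refine ⟨_, Fintype.linearCombination R g, ?_, fun c hc => ?_⟩
  · rw [← LinearMap.range_eq_top, Fintype.range_linearCombination]
    exact span_eq_top_of_tmul_eq_basis g b hg
  · rw [LinearMap.mem_ker, Fintype.linearCombination_apply] at hc
    have h := congrArg (TensorProduct.mk R (ResidueField R) N 1) hc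
    rw [map_sum, map_zero] at h
    have h' : ∑ i, residue R (c i) • b i = 0 := by
      rw [← h]
      refine Finset.sum_congr rfl fun i _ => ?_
      rw [map_smul, hg, ← algebraMap_smul (ResidueField R) (c i) (b i)]
      rfl
    have hc' (i) : c i ∈ maximalIdeal R := by
      have := Fintype.linearIndependent_iff.1 b.linearIndependent _ h' i
      rwa [residue_eq_zero_iff] at this
    rw [pi_eq_sum_univ' c]
    exact sum_mem fun i _ => Submodule.smul_mem_smul (hc' i) trivial

variable [IsNoetherianRing R]

/-- The syzygies of a finitely generated module, with respect to chosen minimal covers. -/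
def syzygy (N : Type u) [AddCommGroup N] [Module R N] [Module.Finite R N] :
    ℕ → {M : ModuleCat.{u} R // Module.Finite R M}
  | 0 => ⟨ModuleCat.of R N, ‹_›⟩
  | n + 1 =>
    letI := (syzygy N n).2
    ⟨ModuleCat.of R (LinearMap.ker (exists_minimal_cover R (syzygy N n).1).choose_spec.choose),
      inferInstanceAs (Module.Finite R (LinearMap.ker _))⟩

open IsLocalRing in
/-- Every finitely generated module over a noetherian local ring has a minimal resolution. -/
theorem exists_isMinimal_isResolution (N : Type u) [AddCommGroup N] [Module R N]
    [Module.Finite R N] : ∃ (V : DiffModule R) (π : V.carrier →ₗ[R] N),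
      V.IsMinimal (maximalIdeal R) ∧ V.IsResolution π := by
  have (n : ℕ) := (syzygy R N n).2
  let b (n : ℕ) : ℕ := (exists_minimal_cover R (syzygy R N n).1).choose
  let ε (n : ℕ) : (Fin (b n) → R) →ₗ[R] (syzygy R N n).1 :=
    (exists_minimal_cover R (syzygy R N n).1).choose_spec.choose
  have hε (n : ℕ) : Function.Surjective (ε n) :=
    (exists_minimal_cover R (syzygy R N n).1).choose_spec.choose_spec.1
  have hker (n : ℕ) : LinearMap.ker (ε n) ≤ maximalIdeal R • ⊤ :=
    (exists_minimal_cover R (syzygy R N n).1).choose_spec.choose_spec.2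
  let δ (n : ℕ) : (Fin (b (n + 1)) → R) →ₗ[R] (Fin (b n) → R) :=
    (LinearMap.ker (ε n)).subtype ∘ₗ ε (n + 1)
  have hεδ (n : ℕ) (a) : ε n (δ n a) = 0 := (ε (n + 1) a : LinearMap.ker (ε n)).2
  have hδε (n : ℕ) (a) (ha : ε n a = 0) : ∃ c, δ n c = a := by
    obtain ⟨c, hc⟩ := hε (n + 1) (⟨a, ha⟩ : LinearMap.ker (ε n))
    exact ⟨c, congrArg Subtype.val hc⟩
  have hδ (n : ℕ) (a) : δ n (δ (n + 1) a) = 0 :=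
    (congrArg (LinearMap.ker (ε n)).subtype (hεδ (n + 1) a)).trans (map_zero _)
  obtain ⟨π, hπ⟩ := DiffModule.exists_isResolution_ofSequence
    (F := fun n => Fin (b n) → R) (δ := δ) hδ
    (show (Fin (b 0) → R) →ₗ[R] N from ε 0) (hε 0) (hεδ 0) (hδε 0)
    (fun n a ha => hδε (n + 1) a (Subtype.ext ha))
  exact ⟨_, π, DiffModule.ofSequence_isMinimal hδ fun n a => hker n (hεδ n a), hπ⟩

end Existence

/-! ### Koszul modules and regular sequences -/

open IsLocalRing RingTheory.Sequence DiffModule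

section Koszul

variable {R : Type u} [CommRing R] {I : Ideal R}

lemma DiffModule.IsMinimal.koszul (x : List I) {V : DiffModule R} (hV : V.IsMinimal I) :
    (DiffModule.koszul (x.map Subtype.val) V).IsMinimal I := by
  induction x generalizing V with
  | nil => exact hV
  | cons y x ih => exact ih (hV.cone y)

lemma DiffModule.lin_koszul_equivalent (x : List I) {V : DiffModule R} (hV : V.IsMinimal I) :
    ((DiffModule.koszul (x.map Subtype.val) V).lin I (hV.koszul x).range_d_le).Equivalent
      (DiffModule.koszul (x.map (degreeOneClass I)) (V.lin I hV.range_d_le)) := by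
  induction x generalizing V with
  | nil => exact .refl _
  | cons y x ih => exact (ih (hV.cone y)).trans ((lin_cone_equivalent V _ y).koszul _)

lemma DiffModule.IsResolution.koszul (l : List R) {M : Type u} [AddCommGroup M] [Module R M]
    (hl : IsWeaklyRegular M l) {V : DiffModule R} {π : V.carrier →ₗ[R] M} (h : V.IsResolution π) :
    ∃ π' : (DiffModule.koszul l V).carrier →ₗ[R] M ⧸ (Ideal.ofList l • ⊤ : Submodule R M),
      (DiffModule.koszul l V).IsResolution π' := by
  induction l generalizing M V with
  | nil => exact ⟨_, h.comp_equiv (Submodule.quotEquivOfEqBot _ (by simp)).symm⟩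
  | cons y l ih =>
    rw [isWeaklyRegular_cons_iff] at hl
    obtain ⟨π', hπ'⟩ := ih hl.2 (h.cone hl.1)
    exact ⟨_, hπ'.comp_equiv (Submodule.quotOfListConsSMulTopEquivQuotSMulTopInner M y l).symm⟩

/-- Elements of degree one generate a proper submodule of a nonzero associated graded module. -/
lemma ofList_degreeOneClass_smul_top_ne_top (x : List I) {M : Type u} [AddCommGroup M] [Module R M]
    (hM : (I • ⊤ : Submodule R M) ≠ ⊤) :
    Ideal.ofList (x.map (degreeOneClass I)) • (⊤ : Submodule (GrRing I) (GrModule I M)) ≠ ⊤ := by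
  intro h
  refine hM (eq_top_iff.2 fun a _ => ?_)
  have key : ∀ ξ ∈ Ideal.ofList (x.map (degreeOneClass I)) •
      (⊤ : Submodule (GrRing I) (GrModule I M)), grComp I 0 ξ = 0 := by
    intro ξ hξ
    induction hξ using Submodule.smul_induction_on' with
    | smul r hr m _ =>
      induction hr using Submodule.span_induction generalizing m with
      | mem r hr =>
        obtain ⟨y, -, rfl⟩ := List.mem_map.1 hr
        exact grComp_degreeOneClass_smul_zero I y m
      | zero => rw [zero_smul, map_zero]
      | add r s _ _ hr hs => rw [add_smul, map_add, hr _ trivial, hs _ trivial, add_zero]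
      | smul r s _ hs => rw [smul_eq_mul, mul_comm, mul_smul, hs _ trivial]
    | add ξ _ η _ h h' => rw [map_add, h, h', add_zero]
  have h0 := key (symb I 0 a (mem_pow_zero_smul_top I M a)) (by rw [h]; trivial)
  rwa [grComp_symb_self, symb_eq_zero_iff, zero_add, pow_one] at h0

lemma isWeaklyRegular_degreeOneClass_cons_iff (M : Type u) [AddCommGroup M] [Module R M]
    (x : List I) (y : I) :
    IsWeaklyRegular (GrModule I M) ((y :: x).map (degreeOneClass I)) ↔
      IsSMulRegular (GrModule I M) (degreeOneClass I y) ∧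
        IsWeaklyRegular (GrModule I (QuotSMulTop (y : R) M)) (x.map (degreeOneClass I)) := by
  rw [List.map_cons, isWeaklyRegular_cons_iff]
  refine and_congr_right fun hy => ?_
  obtain ⟨e⟩ := nonempty_quotSMulTop_equiv hy
  exact e.isWeaklyRegular_congr _

lemma maximalIdeal_smul_top_ne_top [IsLocalRing R] (M : Type u) [AddCommGroup M] [Module R M]
    [Module.Finite R M] [Nontrivial M] : (maximalIdeal R • ⊤ : Submodule R M) ≠ ⊤ :=
  (Submodule.top_ne_ideal_smul_of_le_jacobson_annihilator
    (maximalIdeal_le_jacobson (Module.annihilator R M))).symm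

end Koszul

variable {R : Type u} [CommRing R] [IsLocalRing R] [IsNoetherianRing R]

section OneElement

variable {M N : Type u} [AddCommGroup M] [Module R M] [Module.Finite R M] [AddCommGroup N]
  [Module R N]

lemma isKoszul_congr (e : M ≃ₗ[R] N) : IsKoszul R M ↔ IsKoszul R N := by
  obtain ⟨V, π, hV, hπ⟩ := exists_isMinimal_isResolution R M
  rw [hπ.isKoszul_iff hV, (hπ.comp_equiv e).isKoszul_iff hV]

variable {x : maximalIdeal R}

lemma isKoszul_of_quotSMulTop (hx : IsSMulRegular M (x : R))
    (h : IsKoszul R (QuotSMulTop (x : R) M)) : IsKoszul R M := by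
  obtain ⟨V, π, hV, hπ⟩ := exists_isMinimal_isResolution R M
  rw [(hπ.cone hx).isKoszul_iff (hV.cone x)] at h
  simp only [(lin_cone_equivalent V hV.range_d_le x).exactAt_iff] at h
  rw [hπ.isKoszul_iff hV]
  exact ⟨fun n hn => exactAt_lin_of_exactAt_cone (h.1 n hn),
    fun h0 => h.2 (exactAt_cone _ h0 (exactAt_of_neg _ (by norm_num)))⟩

lemma isSMulRegular_degreeOneClass (hx : IsSMulRegular M (x : R)) (hM : IsKoszul R M)
    (h : IsKoszul R (QuotSMulTop (x : R) M)) :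
    IsSMulRegular (GrModule (maximalIdeal R) M) (degreeOneClass (maximalIdeal R) x) := by
  obtain ⟨V, π, hV, hπ⟩ := exists_isMinimal_isResolution R M
  rw [(hπ.cone hx).isKoszul_iff (hV.cone x)] at h
  simp only [(lin_cone_equivalent V hV.range_d_le x).exactAt_iff] at h
  exact (hπ.lin hV.range_d_le ((hπ.isKoszul_iff hV).1 hM).1).isSMulRegular (h.1 1 one_pos)

lemma isSMulRegular_of_isSMulRegular_degreeOneClass
    (hx : IsSMulRegular (GrModule (maximalIdeal R) M) (degreeOneClass (maximalIdeal R) x)) :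
    IsSMulRegular M (x : R) :=
  isSMulRegular_of_degreeOneClass
    (Ideal.iInf_pow_smul_eq_bot_of_isLocalRing _ (maximalIdeal.isMaximal R).ne_top) hx

lemma isKoszul_quotSMulTop
    (hx : IsSMulRegular (GrModule (maximalIdeal R) M) (degreeOneClass (maximalIdeal R) x))
    (hM : IsKoszul R M) : IsKoszul R (QuotSMulTop (x : R) M) := by
  obtain ⟨V, π, hV, hπ⟩ := exists_isMinimal_isResolution R M
  rw [hπ.isKoszul_iff hV] at hM
  rw [(hπ.cone (isSMulRegular_of_isSMulRegular_degreeOneClass hx)).isKoszul_iff (hV.cone x)]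
  simp only [(lin_cone_equivalent V hV.range_d_le x).exactAt_iff]
  exact ⟨((hπ.lin hV.range_d_le hM.1).cone hx).exactAt,
    fun h0 => hM.2 (exactAt_lin_of_exactAt_cone h0)⟩

end OneElement

section List

variable (M : Type u) [AddCommGroup M] [Module R M] [Module.Finite R M]
  (x : List (maximalIdeal R))

lemma isKoszul_quotient_cons_iff (y : maximalIdeal R) :
    IsKoszul R (M ⧸ (Ideal.ofList ((y :: x).map Subtype.val) • ⊤ : Submodule R M)) ↔
      IsKoszul R (QuotSMulTop (y : R) M ⧸
        (Ideal.ofList (x.map Subtype.val) • ⊤ : Submodule R (QuotSMulTop (y : R) M))) :=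
  isKoszul_congr (Submodule.quotOfListConsSMulTopEquivQuotSMulTopInner M (y : R)
    (x.map Subtype.val))

lemma isKoszul_quotient_nil_iff :
    IsKoszul R (M ⧸ (Ideal.ofList (([] : List (maximalIdeal R)).map Subtype.val) • ⊤ :
      Submodule R M)) ↔ IsKoszul R M :=
  isKoszul_congr (Submodule.quotEquivOfEqBot _ (by simp))

/-- Koszulness ascends from `M / (x) M` to `M` if `x` is a regular sequence on `M`. -/
theorem isKoszul_of_quotient (hx : IsWeaklyRegular M (x.map Subtype.val))
    (h : IsKoszul R (M ⧸ (Ideal.ofList (x.map Subtype.val) • ⊤ : Submodule R M))) :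
    IsKoszul R M := by
  induction x generalizing M with
  | nil => exact (isKoszul_quotient_nil_iff M).1 h
  | cons y x ih =>
    rw [List.map_cons, isWeaklyRegular_cons_iff] at hx
    rw [isKoszul_quotient_cons_iff] at h
    exact isKoszul_of_quotSMulTop hx.1 (ih _ hx.2 h)

/-- If `M` and `M / (x) M` are Koszul, then so are the quotients by all initial parts of `x`, and the
classes of `x` form a regular sequence. -/
theorem isWeaklyRegular_degreeOneClass (hx : IsWeaklyRegular M (x.map Subtype.val))
    (hM : IsKoszul R M)
    (h : IsKoszul R (M ⧸ (Ideal.ofList (x.map Subtype.val) • ⊤ : Submodule R M))) :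
    IsWeaklyRegular (GrModule (maximalIdeal R) M) (x.map (degreeOneClass (maximalIdeal R))) := by
  induction x generalizing M with
  | nil => exact .nil _ _
  | cons y x ih =>
    rw [List.map_cons, isWeaklyRegular_cons_iff] at hx
    rw [isKoszul_quotient_cons_iff] at h
    have hMy := isKoszul_of_quotient _ x hx.2 h
    rw [isWeaklyRegular_degreeOneClass_cons_iff]
    exact ⟨isSMulRegular_degreeOneClass hx.1 hM hMy, ih _ hx.2 hMy h⟩

/-- If the classes of `x` form a regular sequence on the associated graded module, then Koszulness
ascends and descends. -/
theorem isKoszul_quotient_iff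
    (hx : IsWeaklyRegular (GrModule (maximalIdeal R) M) (x.map (degreeOneClass (maximalIdeal R)))) :
    IsKoszul R M ↔
      IsKoszul R (M ⧸ (Ideal.ofList (x.map Subtype.val) • ⊤ : Submodule R M)) := by
  induction x generalizing M with
  | nil => exact (isKoszul_quotient_nil_iff M).symm
  | cons y x ih =>
    rw [isWeaklyRegular_degreeOneClass_cons_iff] at hx
    rw [isKoszul_quotient_cons_iff, ← ih _ hx.2]
    exact ⟨isKoszul_quotSMulTop hx.1,
      isKoszul_of_quotSMulTop (isSMulRegular_of_isSMulRegular_degreeOneClass hx.1)⟩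

/-- The linearity defect of the quotient of a Koszul module by a regular sequence: the linear part
of the minimal resolution of `M / (x) M` computes the Koszul homology of the associated graded
module of `M`. -/
theorem linearityDefect_quotient_eq [Nontrivial M] (hx : IsWeaklyRegular M (x.map Subtype.val))
    (hM : IsKoszul R M) :
    linearityDefect R (M ⧸ (Ideal.ofList (x.map Subtype.val) • ⊤ : Submodule R M)) =
      (x.length : EReal) - depth (Ideal.ofList (x.map (degreeOneClass (maximalIdeal R))))
        (GrModule (maximalIdeal R) M) := by
  obtain ⟨V, π, hV, hπ⟩ := exists_isMinimal_isResolution R M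
  obtain ⟨π', hπ'⟩ := hπ.koszul _ hx
  rw [hπ'.linearityDefect_eq (hV.koszul x)]
  simp only [(lin_koszul_equivalent x hV).exactAt_iff]
  rw [(hπ.lin hV.range_d_le ((hπ.isKoszul_iff hV).1 hM).1).iSup_eq_sub_depth _
    (ofList_degreeOneClass_smul_top_ne_top x (maximalIdeal_smul_top_ne_top M)), List.length_map]

end List

end LinDefect

end

theorem theorem2p11 (R : Type u) [CommRing R] [IsLocalRing R] [IsNoetherianRing R]
    (M : Type u) [AddCommGroup M] [Module R M] [Module.Finite R M]
    (x : List (IsLocalRing.maximalIdeal R)) :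
    letI xR : List R := x.map Subtype.val
    letI xbar : List (LinDefect.GrRing (IsLocalRing.maximalIdeal R)) :=
      x.map (LinDefect.degreeOneClass (IsLocalRing.maximalIdeal R))
    letI grM : Type u := LinDefect.GrModule (IsLocalRing.maximalIdeal R) M
    letI MmodxM : Type u := M ⧸ (Ideal.ofList xR • ⊤ : Submodule R M)
    (RingTheory.Sequence.IsRegular M xR → LinDefect.IsKoszul R M →
      LinDefect.linearityDefect R MmodxM =
          (x.length : EReal) - LinDefect.depth (Ideal.ofList xbar) grM ∧
        (LinDefect.IsKoszul R MmodxM ↔ RingTheory.Sequence.IsRegular grM xbar)) ∧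
    (RingTheory.Sequence.IsRegular M xR → LinDefect.IsKoszul R MmodxM →
      LinDefect.IsKoszul R M) ∧
    (RingTheory.Sequence.IsRegular grM xbar →
      (LinDefect.IsKoszul R M ↔ LinDefect.IsKoszul R MmodxM)) := by
  refine ⟨fun hx hM => ?_, fun hx h => LinDefect.isKoszul_of_quotient M x hx.toIsWeaklyRegular h,
    fun hx => LinDefect.isKoszul_quotient_iff M x hx.toIsWeaklyRegular⟩
  have := hx.nontrivial
  refine ⟨LinDefect.linearityDefect_quotient_eq M x hx.toIsWeaklyRegular hM, fun h => ?_,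
    fun h => (LinDefect.isKoszul_quotient_iff M x h.toIsWeaklyRegular).1 hM⟩
  exact ⟨LinDefect.isWeaklyRegular_degreeOneClass M x hx.toIsWeaklyRegular hM h,
    (LinDefect.ofList_degreeOneClass_smul_top_ne_top x
      (LinDefect.maximalIdeal_smul_top_ne_top M)).symm⟩
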